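/- **Game.** Let $n\ge 2$, $2<p<\infty$, let $\Omega\subset\mathbb R^n$ be a bounded open set and $\varepsilon>0$. Let $B_t(x)$ be the open Euclidean ball and put $$\Gamma_\varepsilon=\{x\in\mathbb R^n\setminus\Omega:\operatorname{dist}(x,\partial\Omega)\le\varepsilon\},\qquad \Omega_\varepsilon=\Omega\cup\Gamma_\varepsilon,\qquad \alpha=\frac{p-2}{n+p},\qquad \beta=1-\alpha=\frac{n+2}{n+p}.$$ Let $F:\Gamma_\varepsilon\to\mathbb R$ be bounded and Borel. In the *random step size tug-of-war with noise* a token starts at $x_0\in\Omega_\varepsilon$. In each round, from the current position $x_k$: with probability $\beta$ the next position $x_{k+1}$ is uniformly distributed on $B_\varepsilon(x_k)$; with probability $\alpha$ a step size $\varepsilon_{k+1}$ is drawn uniformly from $[0,\varepsilon]$, a fair coin is tossed, and its winner (Player I or Player II) chooses $x_{k+1}\in B_{\varepsilon_{k+1}}(x_k)$. A strategy $S_{\rm I}$, $S_{\rm II}$ of a player is a family of Borel functions giving the chosen point as a function of the history of the game (coin tosses, step sizes and positions) and of the next step size. At the first time $\tau\ge 0$ with $x_\tau\notin\Omega$ Player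 II pays $F(x_\tau)$ to Player I. The values of the game for the two players are $$u^\varepsilon_{\rm I}(x_0)=\sup_{S_{\rm I}}\inf_{S_{\rm II}}\mathbb E^{x_0}_{S_{\rm I},S_{\rm II}}[F(x_\tau)],\qquad u^\varepsilon_{\rm II}(x_0)=\inf_{S_{\rm II}}\sup_{S_{\rm I}}\mathbb E^{x_0}_{S_{\rm I},S_{\rm II}}[F(x_\tau)].$$ **Theorem.** For all $n\ge 2$, $2<p<\infty$, $r>0$ and $M\ge 0$ there is a constant $C=C(n,p,r,M)>0$ such that the following holds for every bounded open set $\Omega\subset\mathbb R^n$, every $0<\varepsilon<r$, every bounded Borel function $F$ on $\Gamma_\varepsilon$ and every $z_0$ with $B_{5r}(z_0)\subset\Omega$, provided that $\|u^\varepsilon_{\rm I}\|_{L^\infty(\Omega_\varepsilon)}\le M$. The game has a value, $u_\varepsilon:=u^\varepsilon_{\rm I}=u^\varepsilon_{\rm II}$ in $\Omega_\varepsilon$; for all $x,y\in B_{2r}(z_0)$ $$|u_\varepsilon(x)-u_\varepsilon(y)|\le C\,|x-y|;$$ and for almost every $z\in B_r(z_0)$ the gradient $Du_\varepsilon(z)$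 exists (that is, $u_\varepsilon$ is differentiable at $z$) and satisfies $|Du_\varepsilon(z)|\le C$. -/

import Mathlib

open MeasureTheory ProbabilityTheory Metric
open scoped ENNReal NNReal

noncomputable section

namespace RandomStepTug

/-- `ℝⁿ` with its Euclidean norm. -/
abbrev Space (n : ℕ) := EuclideanSpace ℝ (Fin n)

/-- The outer boundary strip `Γ_ε = {x ∉ Ω : dist(x, ∂Ω) ≤ ε}`. -/
def strip {n : ℕ} (Ω : Set (Space n)) (ε : ℝ) : Set (Space n) :=
  {x | x ∉ Ω ∧ infDist x (frontier Ω) ≤ ε}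

/-- The probability `α = (p - 2) / (n + p)` that a round is a tug-of-war round. -/
def tugProb (n : ℕ) (p : ℝ) : ℝ := (p - 2) / (n + p)

/-- The probability `β = (n + 2) / (p + n)` that a round is a random move. -/
def noiseProb (n : ℕ) (p : ℝ) : ℝ := (n + 2) / (p + n)

/-- One entry `(c, t, x)` of the history of the game: the outcome `c` of the coin tosses of the
round (`0`: random move, `1`: Player I wins, `2`: Player II wins), the step size `t` drawn in the
round, and the position `x` of the token after the round. The entry with index `0` only carries
the starting point. -/
abbrev Round (n : ℕ) := Fin 3 × ℝ × Space n

/-- The position of the token recorded in an entry of the history. -/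
def Round.pos {n : ℕ} (z : Round n) : Space n := z.2.2

/-- The history of the game up to (and including) round `k`. -/
abbrev History (n k : ℕ) := (i : Finset.Iic k) → Round n

/-- The current position of the token. -/
def History.current {n k : ℕ} (h : History n k) : Space n :=
  (h ⟨k, Finset.mem_Iic.2 le_rfl⟩).pos

/-- A (Borel) strategy: given the history of the game and the next step size `t`, it returns the
next position of the token, in the open ball of radius `t` about the current position. -/
structure Strategy (n : ℕ) where
  /-- the next position, used if the player wins the toss -/
  move : (k : ℕ) → History n k × ℝ → Space n
  measurable_move : ∀ k, Measurable (move k)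
  move_mem : ∀ k (h : History n k) (t : ℝ), 0 < t → move k (h, t) ∈ ball h.current t

/-- The law of the coin tosses of one round: a random move with probability `β`, a win of either
player with probability `α / 2`. -/
def coinLaw (n : ℕ) (p : ℝ) : Measure (Fin 3) :=
  ENNReal.ofReal (noiseProb n p) • Measure.dirac 0 +
    (ENNReal.ofReal (tugProb n p / 2) • Measure.dirac 1 +
      ENNReal.ofReal (tugProb n p / 2) • Measure.dirac 2)

/-- The law of the (independent) random choices of one round: the coin tosses, the step size,
uniform on `[0, ε]`, and the displacement of a random move, uniform on `B_ε(0)`. -/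
def noiseLaw (n : ℕ) (p ε : ℝ) : Measure (Fin 3 × ℝ × Space n) :=
  (coinLaw n p).prod ((cond volume (Set.Icc 0 ε)).prod (cond volume (ball (0 : Space n) ε)))

/-- The next entry of the history, given the history `h` and the random choices `w` of the
round. -/
def nextRound {n : ℕ} (SI SII : Strategy n) {k : ℕ} (h : History n k)
    (w : Fin 3 × ℝ × Space n) : Round n :=
  (w.1, w.2.1,
    if w.1 = 0 then h.current + w.2.2
    else if w.1 = 1 then SI.move k (h, w.2.1)
    else SII.move k (h, w.2.1))

theorem isProbabilityMeasure_coinLaw (n : ℕ) {p : ℝ} (hp : 2 < p) :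
    IsProbabilityMeasure (coinLaw n p) := by
  have h1 : 0 ≤ noiseProb n p := by unfold noiseProb; positivity
  have h2 : 0 ≤ tugProb n p / 2 := by
    unfold tugProb
    have : 0 ≤ p - 2 := by linarith
    positivity
  refine ⟨?_⟩
  have h3 : noiseProb n p + (tugProb n p / 2 + tugProb n p / 2) = 1 := by
    have hpn : (p + n : ℝ) ≠ 0 := by positivity
    unfold noiseProb tugProb
    rw [add_comm (n : ℝ) p]
    field_simp
    ring
  simp only [coinLaw, Measure.add_apply, Measure.smul_apply, measure_univ, smul_eq_mul, mul_one]
  rw [← ENNReal.ofReal_add h2 h2, ← ENNReal.ofReal_add h1 (by positivity), h3,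
    ENNReal.ofReal_one]

theorem isProbabilityMeasure_noiseLaw (n : ℕ) {p ε : ℝ} (hp : 2 < p) (hε : 0 < ε) :
    IsProbabilityMeasure (noiseLaw n p ε) := by
  have := isProbabilityMeasure_coinLaw n hp
  have : IsProbabilityMeasure (cond (volume : Measure ℝ) (Set.Icc 0 ε)) :=
    cond_isProbabilityMeasure_of_finite (by simp [hε]) (by simp)
  have : IsProbabilityMeasure (cond volume (ball (0 : Space n) ε)) :=
    cond_isProbabilityMeasure_of_finite (measure_ball_pos volume 0 hε).ne'
      measure_ball_lt_top.ne
  unfold noiseLaw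
  infer_instance

theorem measurable_nextRound {n : ℕ} (SI SII : Strategy n) (k : ℕ) :
    Measurable fun q : History n k × (Fin 3 × ℝ × Space n) => nextRound SI SII q.1 q.2 := by
  have hc : Measurable fun q : History n k × (Fin 3 × ℝ × Space n) => q.2.1 := by fun_prop
  have hcur : Measurable fun h : History n k => h.current := by
    unfold History.current Round.pos
    fun_prop
  refine hc.prodMk (Measurable.prodMk (by fun_prop) ?_)
  refine Measurable.ite (hc (MeasurableSet.singleton 0)) ?_
    (Measurable.ite (hc (MeasurableSet.singleton 1)) ?_ ?_)
  · exact (hcur.comp measurable_fst).add (by fun_prop)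
  · exact (SI.measurable_move k).comp (by fun_prop)
  · exact (SII.measurable_move k).comp (by fun_prop)

/-- The one-step transition probabilities: given the history up to round `k`, the law of the
entry of round `k + 1`. -/
def stepKernel {n : ℕ} {p ε : ℝ} (hp : 2 < p) (hε : 0 < ε) (SI SII : Strategy n) (k : ℕ) :
    Kernel (History n k) (Round n) where
  toFun h := (noiseLaw n p ε).map (nextRound SI SII h)
  measurable' := by
    have := isProbabilityMeasure_noiseLaw n hp hε
    refine Measure.measurable_of_measurable_coe _ fun s hs => ?_
    have hm := measurable_nextRound SI SII k
    have : ∀ h : History n k, (noiseLaw n p ε).map (nextRound SI SII h) s =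
        noiseLaw n p ε (Prod.mk h ⁻¹' ((fun q : History n k × (Fin 3 × ℝ × Space n) =>
          nextRound SI SII q.1 q.2) ⁻¹' s)) := fun h =>
      Measure.map_apply (hm.comp measurable_prodMk_left) hs
    simp_rw [this]
    exact measurable_measure_prodMk_left (hm hs)

instance isMarkovKernel_stepKernel {n : ℕ} {p ε : ℝ} (hp : 2 < p) (hε : 0 < ε)
    (SI SII : Strategy n) (k : ℕ) : IsMarkovKernel (stepKernel hp hε SI SII k) := by
  have := isProbabilityMeasure_noiseLaw n hp hε
  exact ⟨fun h => Measure.isProbabilityMeasure_map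
    ((measurable_nextRound SI SII k).comp measurable_prodMk_left).aemeasurable⟩

/-- The probability measure `ℙ^{x₀}_{S_I, S_II}` on game trajectories, built from the one-step
transition probabilities by the Ionescu-Tulcea theorem. -/
def gameLaw {n : ℕ} {p ε : ℝ} (hp : 2 < p) (hε : 0 < ε) (SI SII : Strategy n) (x₀ : Space n) :
    Measure (ℕ → Round n) :=
  Kernel.traj (X := fun _ => Round n) (stepKernel hp hε SI SII) 0 fun _ => (0, 0, x₀)

open Classical in
/-- The payoff `F(x_τ)`, where `x_τ` is the first position outside `Ω` (a trajectory that never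
leaves `Ω` gets the payoff `0`). -/
def payoff {n : ℕ} (Ω : Set (Space n)) (F : Space n → ℝ) (ω : ℕ → Round n) : ℝ :=
  if h : ∃ k, (ω k).pos ∉ Ω then F (ω (Nat.find h)).pos else 0

/-- The expected payoff `𝔼^{x₀}_{S_I, S_II}[F(x_τ)]`. -/
def expectedPayoff {n : ℕ} {p ε : ℝ} (hp : 2 < p) (hε : 0 < ε) (Ω : Set (Space n))
    (F : Space n → ℝ) (SI SII : Strategy n) (x₀ : Space n) : ℝ :=
  ∫ ω, payoff Ω F ω ∂(gameLaw hp hε SI SII x₀)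

/-- The value of the game for Player I. -/
def valueI {n : ℕ} {p ε : ℝ} (hp : 2 < p) (hε : 0 < ε) (Ω : Set (Space n))
    (F : Space n → ℝ) (x₀ : Space n) : ℝ :=
  ⨆ SI : Strategy n, ⨅ SII : Strategy n, expectedPayoff hp hε Ω F SI SII x₀

/-- The value of the game for Player II. -/
def valueII {n : ℕ} {p ε : ℝ} (hp : 2 < p) (hε : 0 < ε) (Ω : Set (Space n))
    (F : Space n → ℝ) (x₀ : Space n) : ℝ :=
  ⨅ SII : Strategy n, ⨆ SI : Strategy n, expectedPayoff hp hε Ω F SI SII x₀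

end RandomStepTug

end

noncomputable section

namespace RandomStepTug

/-! The game value is the solution of a dynamic programming equation `v = dppOp v` in `Ω`, so the
estimate concerns solutions of this equation. The operator averages suprema and infima over the
random radius and also averages over a ball. Moving the center by `s < ε` changes each average by at
most a multiple of `s / ε` times the oscillation. Hence one application of `dppOp` turns bounded
functions into Lipschitz ones (`abs_dppOp_sub_le`), with a constant that degenerates as `ε → 0`.
This suffices for existence and measurability (`exists_isDppSolution`).

The estimate uniform in `ε` comes from a coupling argument (`barrier_improve`, `sub_le_barrier`).
Two copies of the game start at `x` and `y`, share the noise `w`, and have tug-of-war displacements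
within distance `d` of a common target `c`. When the side wishing to reduce the difference wins, it
moves both copies towards `c`; when its rival wins, `d` grows by at most the step size. A barrier
convex in `w` and strictly concave in `d` loses more in tug rounds than it gains from noise.
Iterating the resulting strict improvement bounds the difference by the barrier plus an overshoot
error, giving `|u x - u y| ≤ A (|x - y| + ε)`. For `|x - y| < ε` this makes the oscillation near `x`
and `y` of order `ε`, and one more use of the smoothing cancels the factor `1 / ε`
(`abs_sub_le_mul_dist_of_dpp`).

To identify `v` with both values, a player who chooses nearly optimal points with summable errors
makes `v` along the stopped game a sub- or supermartingale up to a small error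
(`le_expectedPayoff_add`). The game ends almost surely because of the noise
(`ae_exists_stoppedPos_notMem`), so the limit is the payoff. Rademacher's theorem gives the gradient
bound. -/

/-- The law of the step size: uniform on `[0, ε]`. -/
abbrev stepLaw (ε : ℝ) : Measure ℝ := cond volume (Set.Icc 0 ε)

/-- The law of the displacement of a random move: uniform on `B_ε(0)`. -/
abbrev ballLaw (n : ℕ) (ε : ℝ) : Measure (Space n) := cond volume (ball (0 : Space n) ε)

theorem isProbabilityMeasure_stepLaw {ε : ℝ} (hε : 0 < ε) : IsProbabilityMeasure (stepLaw ε) :=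
  cond_isProbabilityMeasure_of_finite (by simp [hε]) (by simp)

theorem isProbabilityMeasure_ballLaw (n : ℕ) {ε : ℝ} (hε : 0 < ε) :
    IsProbabilityMeasure (ballLaw n ε) :=
  cond_isProbabilityMeasure_of_finite (measure_ball_pos volume 0 hε).ne' measure_ball_lt_top.ne

theorem ae_stepLaw (ε : ℝ) : ∀ᵐ t ∂stepLaw ε, t ∈ Set.Ioc 0 ε := by
  refine Measure.ae_smul_measure ?_ _
  rw [Measure.restrict_congr_set Ioc_ae_eq_Icc.symm]
  exact ae_restrict_mem measurableSet_Ioc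

theorem ae_ballLaw (n : ℕ) (ε : ℝ) : ∀ᵐ h ∂ballLaw n ε, h ∈ ball (0 : Space n) ε :=
  Measure.ae_smul_measure (ae_restrict_mem measurableSet_ball) _

theorem integral_stepLaw {ε : ℝ} (hε : 0 < ε) (f : ℝ → ℝ) :
    ∫ t, f t ∂stepLaw ε = ε⁻¹ * ∫ t in (0 : ℝ)..ε, f t := by
  rw [stepLaw, ProbabilityTheory.cond, integral_smul_measure, intervalIntegral.integral_of_le hε.le,
    integral_Icc_eq_integral_Ioc]
  simp [hε.le]

theorem integrable_of_bound {X : Type*} [MeasurableSpace X] {μ : Measure X} [IsFiniteMeasure μ]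
    {f : X → ℝ} (hf : Measurable f) {K : ℝ} (hK : ∀ x, |f x| ≤ K) : Integrable f μ :=
  Integrable.of_bound hf.aestronglyMeasurable K (ae_of_all _ hK)

/-! ### Averages of ball suprema and of ball translates -/

/-- The supremum of `u` over the open ball `B_t(x)`. -/
def ballSup {n : ℕ} (u : Space n → ℝ) (x : Space n) (t : ℝ) : ℝ := sSup (u '' ball x t)

section BallSup

variable {n : ℕ} {u w : Space n → ℝ} {K : ℝ}

theorem le_ballSup (hK : ∀ x, |u x| ≤ K) {x y : Space n} {t : ℝ} (hy : y ∈ ball x t) :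
    u y ≤ ballSup u x t := by
  refine le_csSup ⟨K, ?_⟩ (Set.mem_image_of_mem _ hy)
  rintro _ ⟨z, -, rfl⟩
  exact (abs_le.1 (hK z)).2

theorem ballSup_le {x : Space n} {t : ℝ} (ht : 0 < t) {c : ℝ} (h : ∀ y ∈ ball x t, u y ≤ c) :
    ballSup u x t ≤ c := by
  refine csSup_le ((nonempty_ball.2 ht).image _) ?_
  rintro _ ⟨z, hz, rfl⟩
  exact h z hz

theorem ballSup_of_nonpos {x : Space n} {t : ℝ} (ht : t ≤ 0) : ballSup u x t = 0 := by
  simp [ballSup, ball_eq_empty.2 ht]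

theorem abs_ballSup_le (hK : ∀ x, |u x| ≤ K) (x : Space n) (t : ℝ) : |ballSup u x t| ≤ K := by
  rcases le_or_gt t 0 with ht | ht
  · rw [ballSup_of_nonpos ht, abs_zero]
    exact (abs_nonneg _).trans (hK x)
  · rw [abs_le]
    exact ⟨(abs_le.1 (hK x)).1.trans (le_ballSup hK (mem_ball_self ht)),
      ballSup_le ht fun y _ => (abs_le.1 (hK y)).2⟩

theorem ballSup_le_ballSup_of_subset (hK : ∀ x, |u x| ≤ K) {x y : Space n} {t t' : ℝ} (ht : 0 < t)
    (h : ball x t ⊆ ball y t') : ballSup u x t ≤ ballSup u y t' :=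
  ballSup_le ht fun _ hz => le_ballSup hK (h hz)

theorem ballSup_mono (hw : ∀ x, |w x| ≤ K) (huw : ∀ x, u x ≤ w x) (x : Space n) (t : ℝ) :
    ballSup u x t ≤ ballSup w x t := by
  rcases le_or_gt t 0 with ht | ht
  · rw [ballSup_of_nonpos ht, ballSup_of_nonpos ht]
  · exact ballSup_le ht fun y hy => (huw y).trans (le_ballSup hw hy)

theorem measurable_ballSup (hK : ∀ x, |u x| ≤ K) (x : Space n) : Measurable (ballSup u x) := by
  -- The supremum over the empty ball is the default `0`, which can break monotonicity at `t = 0`;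
  -- replacing it by `-K` restores it.
  have hm : Monotone fun t => if t ≤ 0 then -K else ballSup u x t := by
    intro s t hst
    rcases le_or_gt t 0 with ht | ht
    · simp [ht, hst.trans ht]
    rcases le_or_gt s 0 with hs | hs
    · simp only [hs, ht.not_ge, if_true, if_false]
      exact (abs_le.1 (abs_ballSup_le hK x t)).1
    · simp only [hs.not_ge, ht.not_ge, if_false]
      exact ballSup_le_ballSup_of_subset hK hs (ball_subset_ball hst)
  have h : ballSup u x = fun t => if t ≤ 0 then 0 else
      (if t ≤ 0 then -K else ballSup u x t) := by
    ext t
    split_ifs with ht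
    · exact ballSup_of_nonpos ht
    · rfl
  rw [h]
  exact Measurable.ite measurableSet_Iic measurable_const hm.measurable

theorem integrable_ballSup (hK : ∀ x, |u x| ≤ K) (x : Space n) (μ : Measure ℝ)
    [IsFiniteMeasure μ] : Integrable (ballSup u x) μ :=
  integrable_of_bound (measurable_ballSup hK x) (abs_ballSup_le hK x)

theorem intervalIntegrable_ballSup (hK : ∀ x, |u x| ≤ K) (x : Space n) (a b : ℝ) :
    IntervalIntegrable (ballSup u x) volume a b := by
  rw [intervalIntegrable_iff]
  exact Measure.integrableOn_of_bounded (by simp) (measurable_ballSup hK x).aestronglyMeasurable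
    (ae_of_all _ (abs_ballSup_le hK x))

/-- With `s = dist x y`, `B_t(x) ⊆ B_{t+s}(y)` compares radii in `[0, ε - s]` at `x` with radii in
`[s, ε]` at `y`. Only two intervals of length `s` remain, and they cost at most `s * O` before
division by `ε`. This is where the random step size matters. -/
theorem integral_ballSup_sub_le (hK : ∀ x, |u x| ≤ K) {x y : Space n} {ε c O : ℝ}
    (hxy : dist x y < ε) (hx : ∀ z ∈ ball x ε, u z ≤ c + O) (hy : ∀ z ∈ ball y ε, c ≤ u z) :
    ∫ t, ballSup u x t ∂stepLaw ε - ∫ t, ballSup u y t ∂stepLaw ε ≤ O * dist x y / ε := by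
  have hε : 0 < ε := dist_nonneg.trans_lt hxy
  set s := dist x y with hs
  have hs0 : 0 ≤ s := dist_nonneg
  have I := fun z a b => intervalIntegrable_ballSup hK z a b
  have h1 : ∫ t in (0 : ℝ)..(ε - s), ballSup u x t ≤ ∫ t in s..ε, ballSup u y t := by
    have h := intervalIntegral.integral_comp_add_right (a := 0) (b := ε - s) (ballSup u y) s
    rw [zero_add, sub_add_cancel] at h
    rw [← h]
    refine intervalIntegral.integral_mono_on_of_le_Ioo (by linarith) (I _ _ _) ?_ fun t ht => ?_
    · simpa using (I y s ε).comp_add_right s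
    · exact ballSup_le_ballSup_of_subset hK ht.1 (ball_subset_ball' (by linarith))
  have h2 : ∫ t in (ε - s)..ε, ballSup u x t ≤ s * (c + O) := by
    have : ∫ t in (ε - s)..ε, ballSup u x t ≤ ∫ t in (ε - s)..ε, (c + O) := by
      refine intervalIntegral.integral_mono_on_of_le_Ioo (by linarith) (I _ _ _) (by simp)
        fun t ht => ?_
      exact ballSup_le (by linarith [ht.1]) fun z hz => hx z (ball_subset_ball ht.2.le hz)
    simpa [mul_add] using this
  have h3 : s * c ≤ ∫ t in (0 : ℝ)..s, ballSup u y t := by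
    have : ∫ t in (0 : ℝ)..s, c ≤ ∫ t in (0 : ℝ)..s, ballSup u y t := by
      refine intervalIntegral.integral_mono_on_of_le_Ioo hs0 (by simp) (I _ _ _) fun t ht => ?_
      exact (hy y (mem_ball_self hε)).trans (le_ballSup hK (mem_ball_self ht.1))
    simpa using this
  have h4 := intervalIntegral.integral_add_adjacent_intervals (I x 0 (ε - s)) (I x (ε - s) ε)
  have h5 := intervalIntegral.integral_add_adjacent_intervals (I y 0 s) (I y s ε)
  rw [integral_stepLaw hε, integral_stepLaw hε, ← mul_sub, inv_mul_eq_div]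
  gcongr
  nlinarith

theorem integral_ballLaw_translate (x : Space n) (ε : ℝ) (u : Space n → ℝ) :
    ∫ h, u (x + h) ∂ballLaw n ε = (volume.real (ball (0 : Space n) ε))⁻¹ * ∫ z in ball x ε, u z := by
  rw [ballLaw, ProbabilityTheory.cond, integral_smul_measure, smul_eq_mul, ENNReal.toReal_inv]
  congr 1
  have := (measurePreserving_add_left (volume : Measure (Space n)) x).setIntegral_preimage_emb
    (measurableEmbedding_addLeft x) u (ball x ε)
  rw [← this]
  congr 2
  ext h
  simp [dist_eq_norm]

/-- `B_ε(y)` contains `B_{ε-s}(x)`, and Bernoulli's inequality bounds `1 - (1 - s/ε)^n` by `n s /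
ε`. -/
theorem measureReal_ball_diff_le {x y : Space n} {ε : ℝ} (hxy : dist x y < ε) :
    volume.real (ball x ε \ ball y ε) ≤ volume.real (ball (0 : Space n) ε) * (n * dist x y / ε) := by
  have hε : 0 < ε := dist_nonneg.trans_lt hxy
  set s := dist x y with hs
  have hs0 : 0 ≤ s := dist_nonneg
  have h1 : ball x ε \ ball y ε ⊆ ball x ε \ ball x (ε - s) :=
    Set.sdiff_subset_sdiff_right (ball_subset_ball' (by linarith))
  have h2 : volume.real (ball x ε \ ball x (ε - s)) =
      volume.real (ball x ε) - volume.real (ball x (ε - s)) :=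
    measureReal_sdiff (ball_subset_ball (by linarith)) measurableSet_ball measure_ball_lt_top.ne
  have hb : ∀ (z : Space n) {r : ℝ}, 0 < r →
      volume.real (ball z r) = r ^ n * volume.real (ball (0 : Space n) 1) := by
    intro z r hr
    rw [measureReal_def, Measure.addHaar_ball_of_pos _ _ hr, ENNReal.toReal_mul,
      ENNReal.toReal_ofReal (by positivity), measureReal_def]
    simp
  have h4 : volume.real (ball x ε \ ball y ε) ≤ volume.real (ball x ε \ ball x (ε - s)) :=
    measureReal_mono h1 ((measure_mono Set.sdiff_subset).trans_lt measure_ball_lt_top).ne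
  refine h4.trans ?_
  rw [h2, hb x hε, hb x (by linarith : 0 < ε - s), hb 0 hε]
  have h5 := one_add_mul_le_pow (a := -(s / ε)) (by
    have : s / ε ≤ 1 := (div_le_one hε).2 hxy.le
    linarith) n
  have h6 : (ε - s) ^ n = ε ^ n * (1 + -(s / ε)) ^ n := by
    rw [← mul_pow]
    congr 1
    field_simp
    ring
  rw [h6]
  have h7 : 0 ≤ ε ^ n * volume.real (ball (0 : Space n) 1) := by positivity
  have h8 : (n : ℝ) * s / ε = n * (s / ε) := by ring
  rw [h8]
  nlinarith

/-- After subtracting the lower bound `c`, the common part of the balls favors `y`, so only `B_ε(x)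
\ B_ε(y)` contributes, with integrand at most `O`. -/
theorem integral_ballLaw_sub_le (hu : Measurable u) (hK : ∀ x, |u x| ≤ K) {x y : Space n}
    {ε c O : ℝ} (hxy : dist x y < ε) (hx : ∀ z ∈ ball x ε, u z ≤ c + O)
    (hy : ∀ z ∈ ball y ε, c ≤ u z) :
    ∫ h, u (x + h) ∂ballLaw n ε - ∫ h, u (y + h) ∂ballLaw n ε ≤ n * (O * dist x y / ε) := by
  have hε : 0 < ε := dist_nonneg.trans_lt hxy
  have hO : 0 ≤ O := by
    have h1 := hx y (by rwa [mem_ball, dist_comm])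
    have h2 := hy y (mem_ball_self hε)
    linarith
  have := isProbabilityMeasure_ballLaw n hε
  have hV : 0 < volume.real (ball (0 : Space n) ε) :=
    ENNReal.toReal_pos (measure_ball_pos volume 0 hε).ne' measure_ball_lt_top.ne
  have hI : ∀ s : Set (Space n), volume s ≠ ∞ → IntegrableOn (fun z => u z - c) s := fun s hs =>
    Measure.integrableOn_of_bounded hs (M := K + |c|) (hu.sub_const c).aestronglyMeasurable
      (ae_of_all _ fun z => (abs_sub _ _).trans (by gcongr; exact hK z))
  have hv : ∀ z, ∫ h, u (z + h) ∂ballLaw n ε =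
      (volume.real (ball (0 : Space n) ε))⁻¹ * (∫ w in ball z ε, (u w - c)) + c := by
    intro z
    rw [← integral_ballLaw_translate z ε fun w => u w - c, integral_sub]
    · simp
    · exact integrable_of_bound (hu.comp (measurable_const_add z)) fun h => hK _
    · simp
  have h1 : ∫ w in ball x ε, (u w - c) =
      (∫ w in ball x ε ∩ ball y ε, (u w - c)) + ∫ w in ball x ε \ ball y ε, (u w - c) :=
    (integral_inter_add_sdiff measurableSet_ball (hI _ measure_ball_lt_top.ne)).symm
  have h2 : ∫ w in ball x ε ∩ ball y ε, (u w - c) ≤ ∫ w in ball y ε, (u w - c) := by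
    refine setIntegral_mono_set (hI _ measure_ball_lt_top.ne) ?_
      (Set.inter_subset_right.eventuallyLE)
    filter_upwards [ae_restrict_mem measurableSet_ball] with z hz
    simpa using hy z hz
  have hfin : volume (ball x ε \ ball y ε) < ∞ :=
    (measure_mono Set.sdiff_subset).trans_lt measure_ball_lt_top
  have h3 : ∫ w in ball x ε \ ball y ε, (u w - c) ≤ O * volume.real (ball x ε \ ball y ε) := by
    have : ∫ w in ball x ε \ ball y ε, (u w - c) ≤ ∫ w in ball x ε \ ball y ε, O := by
      refine setIntegral_mono_on (hI _ hfin.ne) ?_ (measurableSet_ball.diff measurableSet_ball)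
        fun z hz => ?_
      · exact integrableOn_const hfin.ne
      · linarith [hx z hz.1]
    simpa [mul_comm] using this
  have h4 := measureReal_ball_diff_le hxy
  rw [hv x, hv y]
  have h5 : (∫ w in ball x ε, (u w - c)) - ∫ w in ball y ε, (u w - c) ≤
      volume.real (ball (0 : Space n) ε) * (n * (O * dist x y / ε)) := by
    have := mul_le_mul_of_nonneg_left h4 hO
    calc _ ≤ O * volume.real (ball x ε \ ball y ε) := by linarith
      _ ≤ _ := this.trans (le_of_eq (by ring))
  rw [add_sub_add_right_eq_sub, ← mul_sub, inv_mul_le_iff₀ hV]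
  exact h5

end BallSup

/-! ### The dynamic programming operator and its solutions -/

/-- The right-hand side of the dynamic programming principle. -/
def dppOp {n : ℕ} (a b ε : ℝ) (u : Space n → ℝ) (x : Space n) : ℝ :=
  a / 2 * (∫ t, ballSup u x t ∂stepLaw ε - ∫ t, ballSup (fun z => -u z) x t ∂stepLaw ε) +
    b * ∫ h, u (x + h) ∂ballLaw n ε

section DppOp

variable {n : ℕ} {u w : Space n → ℝ} {K a b ε : ℝ}

theorem dppOp_neg (u : Space n → ℝ) (x : Space n) :
    dppOp a b ε (fun z => -u z) x = -dppOp a b ε u x := by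
  simp only [dppOp, neg_neg, integral_neg]
  ring

theorem dppOp_mono (ha : 0 ≤ a) (hb : 0 ≤ b) (hε : 0 < ε) (hu : Measurable u) (hw : Measurable w)
    (huK : ∀ x, |u x| ≤ K) (hwK : ∀ x, |w x| ≤ K) (huw : ∀ x, u x ≤ w x) (x : Space n) :
    dppOp a b ε u x ≤ dppOp a b ε w x := by
  have := isProbabilityMeasure_stepLaw hε
  have := isProbabilityMeasure_ballLaw n hε
  have hu' : ∀ x, |-u x| ≤ K := by simpa using huK
  have hw' : ∀ x, |-w x| ≤ K := by simpa using hwK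
  unfold dppOp
  gcongr ?_ * (?_ - ?_) + ?_ * ?_
  · exact integral_mono (integrable_ballSup huK x _) (integrable_ballSup hwK x _)
      (ballSup_mono hwK huw x)
  · exact integral_mono (integrable_ballSup hw' x _) (integrable_ballSup hu' x _)
      (ballSup_mono hu' (fun x => neg_le_neg (huw x)) x)
  · exact integral_mono (integrable_of_bound (hu.comp (measurable_const_add x)) fun h => huK _)
      (integrable_of_bound (hw.comp (measurable_const_add x)) fun h => hwK _) fun h => huw _

theorem abs_integral_le_of_bound {X : Type*} [MeasurableSpace X] {μ : Measure X}
    [IsProbabilityMeasure μ] {f : X → ℝ} {K : ℝ} (hK : ∀ x, |f x| ≤ K) : |∫ x, f x ∂μ| ≤ K := by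
  simpa using norm_integral_le_of_norm_le_const (μ := μ) (f := f) (ae_of_all _ hK)

theorem abs_dppOp_le (ha : 0 ≤ a) (hb : 0 ≤ b) (hab : a + b = 1) (hε : 0 < ε)
    (huK : ∀ x, |u x| ≤ K) (x : Space n) : |dppOp a b ε u x| ≤ K := by
  have := isProbabilityMeasure_stepLaw hε
  have := isProbabilityMeasure_ballLaw n hε
  have h1 := abs_le.1 (abs_integral_le_of_bound (μ := stepLaw ε) (abs_ballSup_le huK x))
  have h2 := abs_le.1 (abs_integral_le_of_bound (μ := stepLaw ε)
    (abs_ballSup_le (u := fun z => -u z) (K := K) (by simpa using huK) x))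
  have h3 := abs_le.1 (abs_integral_le_of_bound (μ := ballLaw n ε) (f := fun h => u (x + h))
    fun h => huK _)
  have hb' : b = 1 - a := by linarith
  unfold dppOp
  rw [abs_le]
  constructor <;> nlinarith

theorem dppOp_sub_le (ha : 0 ≤ a) (hb : 0 ≤ b) (hab : a + b = 1) (hu : Measurable u)
    (huK : ∀ x, |u x| ≤ K) {x y : Space n} {c O : ℝ} (hxy : dist x y < ε)
    (hx : ∀ z ∈ ball x ε ∪ ball y ε, c ≤ u z ∧ u z ≤ c + O) :
    dppOp a b ε u x - dppOp a b ε u y ≤ (n + 1) * O / ε * dist x y := by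
  have hε : 0 < ε := dist_nonneg.trans_lt hxy
  have h1 := integral_ballSup_sub_le huK hxy (fun z hz => (hx z (.inl hz)).2)
    (fun z hz => (hx z (.inr hz)).1)
  have h2 := integral_ballSup_sub_le (u := fun z => -u z) (K := K) (by simpa using huK)
    (c := -(c + O)) (O := O) (ε := ε) (x := y) (y := x) (by rwa [dist_comm])
    (fun z hz => by linarith [(hx z (.inr hz)).1])
    (fun z hz => by linarith [(hx z (.inl hz)).2])
  have h3 := integral_ballLaw_sub_le hu huK hxy (fun z hz => (hx z (.inl hz)).2)
    (fun z hz => (hx z (.inr hz)).1)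
  have hO : 0 ≤ O := by
    have h1 := hx y (.inr (mem_ball_self hε))
    linarith [h1.1, h1.2]
  rw [dist_comm y x] at h2
  unfold dppOp
  have hq : 0 ≤ O * dist x y / ε := by positivity
  have e : (n + 1) * O / ε * dist x y = (n + 1) * (O * dist x y / ε) := by ring
  rw [e]
  set q := O * dist x y / ε
  have h4 := mul_le_mul_of_nonneg_left h3 hb
  have h5 := mul_le_mul_of_nonneg_left (add_le_add h1 h2) (by linarith : 0 ≤ a / 2)
  have h6 : b * (n * q) ≤ n * q := mul_le_of_le_one_left (by positivity) (by linarith)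
  have h7 : a / 2 * (q + q) ≤ q := by nlinarith
  linarith

theorem abs_dppOp_sub_le (ha : 0 ≤ a) (hb : 0 ≤ b) (hab : a + b = 1) (hu : Measurable u)
    (huK : ∀ x, |u x| ≤ K) {x y : Space n} {c O : ℝ} (hxy : dist x y < ε)
    (hx : ∀ z ∈ ball x ε ∪ ball y ε, c ≤ u z ∧ u z ≤ c + O) :
    |dppOp a b ε u x - dppOp a b ε u y| ≤ (n + 1) * O / ε * dist x y := by
  rw [abs_le]
  have h1 := dppOp_sub_le ha hb hab hu huK hxy hx
  have h2 := dppOp_sub_le ha hb hab hu huK (x := y) (y := x) (ε := ε) (by rwa [dist_comm])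
    (fun z hz => hx z hz.symm)
  rw [dist_comm y x] at h2
  constructor <;> linarith

theorem measurable_of_lipschitz_of_eqOn_compl {Ω : Set (Space n)} (hΩ : IsOpen Ω)
    {G : Space n → ℝ} (hG : Measurable G) {L : ℝ}
    (hL : ∀ x ∈ Ω, ∀ y ∈ Ω, |u x - u y| ≤ L * dist x y) (h : ∀ x ∉ Ω, u x = G x) :
    Measurable u := by
  have hc : ContinuousOn u Ω := by
    have : LipschitzOnWith L.toNNReal u Ω := LipschitzOnWith.of_dist_le_mul fun x hx y hy => by
      rw [Real.dist_eq]
      refine (hL x hx y hy).trans ?_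
      gcongr
      exact Real.le_coe_toNNReal L
    exact this.continuousOn
  refine measurable_of_restrict_of_restrict_compl hΩ.measurableSet
    (continuousOn_iff_continuous_domRestrict.1 hc).measurable ?_
  have : Ωᶜ.domRestrict u = Ωᶜ.domRestrict G := by
    ext x
    exact h x x.2
  rw [this]
  exact hG.comp measurable_subtype_coe

/-- A bounded solution of the dynamic programming principle with boundary values `G`. -/
structure IsDppSolution (a b ε : ℝ) (Ω : Set (Space n)) (G v : Space n → ℝ) (K L : ℝ) :
    Prop where
  eq_dppOp : ∀ x ∈ Ω, v x = dppOp a b ε v x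
  eq_boundary : ∀ x ∉ Ω, v x = G x
  bound : ∀ x, |v x| ≤ K
  lipschitz : ∀ x ∈ Ω, ∀ y ∈ Ω, |v x - v y| ≤ L * dist x y
  measurable : Measurable v

-- Knaster–Tarski on functions that are uniformly Lipschitz in `Ω` and equal `G` outside. The
-- smoothing of `dppOp` preserves this class, and so does an arbitrary supremum, so the largest
-- subsolution is automatically Borel.
open Classical in
theorem exists_isDppSolution (ha : 0 ≤ a) (hb : 0 ≤ b) (hab : a + b = 1) (hε : 0 < ε)
    {Ω : Set (Space n)} (hΩ : IsOpen Ω) {G : Space n → ℝ} (hG : Measurable G)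
    (hGK : ∀ x, |G x| ≤ K) :
    ∃ v, IsDppSolution a b ε Ω G v K ((n + 1) * (2 * K) / ε) := by
  have hK : 0 ≤ K := (abs_nonneg _).trans (hGK 0)
  set L : ℝ := (n + 1) * (2 * K) / ε with hLdef
  have hL0 : 0 ≤ L := by positivity
  let T : (Space n → ℝ) → Space n → ℝ := fun w x => if x ∈ Ω then dppOp a b ε w x else G x
  let W : Set (Space n → ℝ) := {w | (∀ x ∉ Ω, w x = G x) ∧ (∀ x, |w x| ≤ K) ∧
    ∀ x ∈ Ω, ∀ y ∈ Ω, |w x - w y| ≤ L * dist x y}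
  have hWm : ∀ w ∈ W, Measurable w := fun w hw =>
    measurable_of_lipschitz_of_eqOn_compl hΩ hG hw.2.2 hw.1
  have hTW : ∀ w ∈ W, T w ∈ W := by
    intro w hw
    have hTb : ∀ x, |T w x| ≤ K := fun x => by
      by_cases hx : x ∈ Ω
      · simpa [T, hx] using abs_dppOp_le ha hb hab hε hw.2.1 x
      · simpa [T, hx] using hGK x
    refine ⟨fun x hx => by simp [T, hx], hTb, fun x hx y hy => ?_⟩
    rcases lt_or_ge (dist x y) ε with hxy | hxy
    · have := abs_dppOp_sub_le ha hb hab (hWm w hw) hw.2.1 (c := -K) (O := 2 * K) hxy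
        fun z _ => ⟨(abs_le.1 (hw.2.1 z)).1, by linarith [(abs_le.1 (hw.2.1 z)).2]⟩
      simpa [T, hx, hy] using this
    · have h1 := (abs_sub (T w x) (T w y)).trans (add_le_add (hTb x) (hTb y))
      have h2 : (2 * K) ≤ L * dist x y := by
        rw [hLdef, div_mul_eq_mul_div, le_div_iff₀ hε]
        calc 2 * K * ε ≤ 2 * K * dist x y := by gcongr
          _ ≤ (n + 1) * (2 * K * dist x y) :=
            le_mul_of_one_le_left (by positivity) (by
              have : (0 : ℝ) ≤ n := Nat.cast_nonneg n
              linarith)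
          _ = _ := by ring
      linarith
  have hTmono : ∀ w ∈ W, ∀ w' ∈ W, (∀ x, w x ≤ w' x) → ∀ x, T w x ≤ T w' x := by
    intro w hw w' hw' h x
    by_cases hx : x ∈ Ω
    · simpa [T, hx] using dppOp_mono ha hb hε (hWm w hw) (hWm w' hw') hw.2.1 hw'.2.1 h x
    · simp [T, hx]
  let S : Set (Space n → ℝ) := {w | w ∈ W ∧ ∀ x, w x ≤ T w x}
  have hSne : S.Nonempty := by
    have hw0 : (fun x => if x ∈ Ω then -K else G x) ∈ W := by
      refine ⟨fun x hx => by simp [hx], fun x => ?_, fun x hx y hy => ?_⟩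
      · by_cases hx : x ∈ Ω
        · simp [hx, abs_of_nonneg hK]
        · simpa [hx] using hGK x
      · simp only [hx, hy, if_true, sub_self, abs_zero]
        positivity
    refine ⟨_, hw0, fun x => ?_⟩
    by_cases hx : x ∈ Ω
    · simpa only [hx, if_true] using (abs_le.1 ((hTW _ hw0).2.1 x)).1
    · simp [T, hx]
  have hbdd : ∀ x, BddAbove ((fun w : Space n → ℝ => w x) '' S) := fun x => ⟨K, by
    rintro _ ⟨w, hw, rfl⟩
    exact (abs_le.1 (hw.1.2.1 x)).2⟩
  let v : Space n → ℝ := fun x => sSup ((fun w : Space n → ℝ => w x) '' S)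
  have hle : ∀ w ∈ S, ∀ x, w x ≤ v x := fun w hw x => le_csSup (hbdd x) ⟨w, hw, rfl⟩
  have hsup : ∀ x c, (∀ w ∈ S, w x ≤ c) → v x ≤ c := by
    intro x c h
    refine csSup_le (hSne.image _) ?_
    rintro _ ⟨w, hw, rfl⟩
    exact h w hw
  obtain ⟨w₀, hw₀⟩ := hSne
  have hvW : v ∈ W := by
    refine ⟨fun x hx => le_antisymm (hsup x _ fun w hw => (hw.1.1 x hx).le)
      ((hw₀.1.1 x hx).symm.le.trans (hle w₀ hw₀ x)), fun x => abs_le.2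
      ⟨(abs_le.1 (hw₀.1.2.1 x)).1.trans (hle w₀ hw₀ x),
        hsup x _ fun w hw => (abs_le.1 (hw.1.2.1 x)).2⟩, ?_⟩
    have key : ∀ x ∈ Ω, ∀ y ∈ Ω, v x ≤ v y + L * dist x y := fun x hx y hy =>
      hsup x _ fun w hw => by
        have h1 := (abs_le.1 (hw.1.2.2 x hx y hy)).2
        have h2 := hle w hw y
        linarith
    intro x hx y hy
    have h1 := key x hx y hy
    have h2 := key y hy x hx
    rw [dist_comm y x] at h2
    rw [abs_le]
    constructor <;> linarith
  have hvT : ∀ x, v x ≤ T v x := fun x => hsup x _ fun w hw =>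
    (hw.2 x).trans (hTmono w hw.1 v hvW (hle w hw) x)
  -- `T v` is again a subsolution, so maximality of `v` gives `T v ≤ v`.
  have hTv : T v ∈ S := ⟨hTW v hvW, hTmono v hvW _ (hTW v hvW) hvT⟩
  have hfix : ∀ x, v x = T v x := fun x => le_antisymm (hvT x) (hle _ hTv x)
  refine ⟨v, ⟨fun x hx => ?_, hvW.1, hvW.2.1, hvW.2.2, hWm v hvW⟩⟩
  simpa [T, hx] using hfix x

end DppOp

/-! ### The barrier argument and the uniform Lipschitz estimate -/

section Barrier

variable {n : ℕ} {u : Space n → ℝ} {K a b ε : ℝ}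

theorem integral_inner_ballLaw (w : Space n) (ε : ℝ) :
    ∫ h, inner ℝ w h ∂ballLaw n ε = 0 := by
  have h : ∫ h in ball (0 : Space n) ε, inner ℝ w h = 0 := by
    rw [← integral_indicator measurableSet_ball]
    set f := (ball (0 : Space n) ε).indicator fun h => inner ℝ w h with hf
    have h1 : ∀ x, f (-x) = -f x := fun x => by
      by_cases hx : x ∈ ball (0 : Space n) ε
      · have hx' : -x ∈ ball (0 : Space n) ε := by simpa using hx
        simp [hf, hx, hx', -mem_ball]
      · have hx' : -x ∉ ball (0 : Space n) ε := by simpa using hx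
        simp [hf, hx, hx', -mem_ball]
    have h2 := integral_neg_eq_self f (volume : Measure (Space n))
    simp only [h1, integral_neg] at h2
    linarith
  rw [ballLaw, ProbabilityTheory.cond, integral_smul_measure, h, smul_zero]

theorem integral_norm_add_sq_le (w : Space n) (hε : 0 < ε) :
    ∫ h, ‖w + h‖ ^ 2 ∂ballLaw n ε ≤ ‖w‖ ^ 2 + ε ^ 2 ∧
      Integrable (fun h => ‖w + h‖ ^ 2) (ballLaw n ε) := by
  have := isProbabilityMeasure_ballLaw n hε
  have hb : ∀ᵐ h ∂ballLaw n ε, ‖h‖ < ε := by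
    filter_upwards [ae_ballLaw n ε] with h hh
    simpa using hh
  have i1 : Integrable (fun h => inner ℝ w h) (ballLaw n ε) := by
    refine Integrable.of_bound (by fun_prop) (‖w‖ * ε) ?_
    filter_upwards [hb] with h hh
    exact (norm_inner_le_norm w h).trans (by gcongr)
  have i2 : Integrable (fun h : Space n => ‖h‖ ^ 2) (ballLaw n ε) := by
    refine Integrable.of_bound (by fun_prop) (ε ^ 2) ?_
    filter_upwards [hb] with h hh
    rw [Real.norm_of_nonneg (by positivity)]
    gcongr
  have e : (fun h => ‖w + h‖ ^ 2) = fun h => (‖w‖ ^ 2 + 2 * inner ℝ w h) + ‖h‖ ^ 2 := by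
    ext h
    exact norm_add_sq_real w h
  have i3 : Integrable (fun h => ‖w‖ ^ 2 + 2 * inner ℝ w h) (ballLaw n ε) :=
    (integrable_const _).add (i1.const_mul 2)
  rw [e]
  refine ⟨?_, i3.add i2⟩
  rw [integral_add i3 i2, integral_add (integrable_const _) (i1.const_mul 2),
    integral_const_mul, integral_inner_ballLaw]
  have h2 : ∫ h : Space n, ‖h‖ ^ 2 ∂ballLaw n ε ≤ ∫ h : Space n, ε ^ 2 ∂ballLaw n ε := by
    refine integral_mono_ae i2 (integrable_const _) ?_
    filter_upwards [hb] with h hh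
    gcongr
  simpa using h2

theorem integral_sq_stepLaw (hε : 0 < ε) : ∫ t, t ^ 2 ∂stepLaw ε = ε ^ 2 / 3 := by
  rw [integral_stepLaw hε, integral_pow]
  field_simp
  norm_num

theorem integrable_sq_stepLaw (hε : 0 < ε) : Integrable (fun t => t ^ 2) (stepLaw ε) := by
  have := isProbabilityMeasure_stepLaw hε
  refine Integrable.of_bound (by fun_prop) (ε ^ 2) ?_
  filter_upwards [ae_stepLaw ε] with t ht
  rw [Real.norm_of_nonneg (by positivity)]
  have := ht.1
  gcongr
  exact ht.2

theorem ballSup_add_ballSup_neg_le {x y : Space n} {t C : ℝ} (ht : 0 < t)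
    (h : ∀ z ∈ ball x t, ∀ z' ∈ ball y t, u z - u z' ≤ C) :
    ballSup u x t + ballSup (fun z => -u z) y t ≤ C := by
  suffices ballSup u x t ≤ C - ballSup (fun z => -u z) y t by linarith
  refine ballSup_le ht fun z hz => ?_
  suffices ballSup (fun z => -u z) y t ≤ C - u z by linarith
  exact ballSup_le ht fun z' hz' => by linarith [h z hz z' hz']

/-- The smooth part of the barrier; `d` is the distance of the tug-of-war displacements to their
common target and `w` the accumulated noise. -/
def barrier (N l R d : ℝ) (w : Space n) : ℝ := N * (‖w‖ ^ 2 + l * (4 * R * d - d ^ 2))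

theorem dist_lineMap_target_le {x c : Space n} {d s : ℝ} (hx : dist x c ≤ d) (hs : s ≤ d)
    (hd : 0 < d) :
    dist (x + (s / d) • (c - x)) c ≤ d - s := by
  have e : x + (s / d) • (c - x) - c = (1 - s / d) • (x - c) := by module
  have h1 : s / d ≤ 1 := (div_le_one hd).2 hs
  rw [dist_eq_norm, e, norm_smul, Real.norm_of_nonneg (by linarith), ← dist_eq_norm]
  calc (1 - s / d) * dist x c ≤ (1 - s / d) * d := by gcongr
    _ = d - s := by field_simp

/-- One step of the comparison with the barrier. -/
theorem barrier_improve (ha : 0 < a) (hb : 0 ≤ b) (hab : a + b = 1) (hu : Measurable u)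
    (huK : ∀ x, |u x| ≤ K) {R M : ℝ} (hε : 0 < ε) (hεR : ε ≤ R) {c : Space n}
    (hdpp : ∀ x ∈ ball c (2 * R), u x = dppOp a b ε u x) (huM : ∀ x ∈ ball c (4 * R), |u x| ≤ M)
    {N l J : ℝ} (hN : 2 * M ≤ N * R ^ 2) (hN0 : 0 < N) (hl : l = 6 / a)
    (hJ : J = 5 * R * ε * N * l) {θ : ℝ} (hθ : 0 ≤ θ)
    (ih : ∀ x y w : Space n, ∀ d, dist x c ≤ d → dist y c ≤ d → d < 2 * R → ‖w‖ < 2 * R →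
      u (x + w) - u (y + w) ≤ barrier N l R d w + J + θ)
    (x y w : Space n) (d : ℝ) (hxd : dist x c ≤ d) (hyd : dist y c ≤ d) (hd : d < 2 * R)
    (hw : ‖w‖ < 2 * R) :
    u (x + w) - u (y + w) ≤ barrier N l R d w + J + max (θ - N * ε ^ 2) 0 := by
  have hR : 0 < R := hε.trans_le hεR
  have hd0 : 0 ≤ d := dist_nonneg.trans hxd
  have hl6 : 1 ≤ l := by
    rw [hl, le_div_iff₀ ha]
    linarith
  have hJ0 : 0 ≤ J := by rw [hJ]; positivity
  have hmem : ∀ z : Space n, dist z c ≤ d → dist (z + w) c ≤ d + ‖w‖ := fun z hz => by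
    have : dist (z + w) z ≤ ‖w‖ := by simp [dist_eq_norm]
    linarith [dist_triangle (z + w) z c]
  -- Away from the core the barrier alone exceeds `N R² ≥ 2M`. In the core, one round stays within
  -- `d, ‖w‖ < 2R`, where `ih` applies.
  by_cases hout : R ≤ d ∨ R ≤ ‖w‖
  · have hx4 := abs_le.1 (huM (x + w) (mem_ball.2 ((hmem x hxd).trans_lt (by linarith))))
    have hy4 := abs_le.1 (huM (y + w) (mem_ball.2 ((hmem y hyd).trans_lt (by linarith))))
    have hbar : N * R ^ 2 ≤ barrier N l R d w := by
      unfold barrier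
      have hq : 0 ≤ 4 * R * d - d ^ 2 := by nlinarith
      gcongr
      rcases hout with h | h
      · have : R ^ 2 ≤ 4 * R * d - d ^ 2 := by nlinarith
        nlinarith [sq_nonneg ‖w‖]
      · nlinarith [mul_nonneg (zero_le_one.trans hl6) hq]
    have := le_max_right (θ - N * ε ^ 2) 0
    linarith
  push Not at hout
  obtain ⟨hdR, hwR⟩ := hout
  -- For `d = 0` both points are the target; this case is split off because the pull towards `c`
  -- below uses the fraction `s / d`.
  rcases hd0.eq_or_lt with hd00 | hdpos
  · have h1 : x = c := dist_le_zero.1 (hxd.trans hd00.symm.le)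
    have h2 : y = c := dist_le_zero.1 (hyd.trans hd00.symm.le)
    have hbar : 0 ≤ barrier N l R d w := by
      rw [barrier, ← hd00]
      simp only [mul_zero, ne_eq, OfNat.ofNat_ne_zero, not_false_eq_true, zero_pow, sub_zero,
        add_zero]
      positivity
    rw [h1, h2, sub_self]
    have := le_max_right (θ - N * ε ^ 2) 0
    linarith
  have := isProbabilityMeasure_stepLaw hε
  have := isProbabilityMeasure_ballLaw n hε
  have hnegK : ∀ x, |(fun z => -u z) x| ≤ K := by simpa using huK
  set B := barrier N l R d w with hB
  -- tug-of-war rounds won by the maximizer of the difference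
  have hup : ∀ t, 0 < t → t ≤ ε → ballSup u (x + w) t + ballSup (fun z => -u z) (y + w) t ≤
      barrier N l R (d + t) w + J + θ := by
    intro t ht htε
    refine ballSup_add_ballSup_neg_le ht fun z hz z' hz' => ?_
    have key : ∀ p q : Space n, dist p c ≤ d → q ∈ ball (p + w) t → dist (q - w) c ≤ d + t := by
      intro p q hp hq
      have : dist (q - w) p = dist q (p + w) := by
        rw [dist_eq_norm, dist_eq_norm]
        congr 1
        abel
      linarith [dist_triangle (q - w) p c, mem_ball.1 hq]
    simpa using ih (z - w) (z' - w) w (d + t) (key x z hxd hz) (key y z' hyd hz') (by linarith) hw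
  -- tug-of-war rounds won by the minimizer of the difference
  have hdown : ∀ t, 0 < t → t ≤ ε → ballSup u (x + w) t + ballSup (fun z => -u z) (y + w) t -
      (ballSup (fun z => -u z) (x + w) t + ballSup u (y + w) t) ≤
      2 * (B + J + θ) - 2 * N * l * t ^ 2 := by
    intro t ht htε
    have hpick : ∀ z ∈ ball (x + w) t, ∀ z' ∈ ball (y + w) t,
        -(ballSup (fun z => -u z) (x + w) t + ballSup u (y + w) t) ≤ u z - u z' := by
      intro z hz z' hz'
      have h1 := le_ballSup hnegK hz
      have h2 := le_ballSup huK hz'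
      linarith
    have hup := hup t ht htε
    -- If `d < t`, both copies can land on `c + w`, where the difference is zero. The constant `J`
    -- pays for the formal value of the barrier at the negative distance `d - t`. Otherwise
    -- concavity in `d` yields the gain `2 N l t²`.
    rcases lt_or_ge d t with hdt | hdt
    · have hm : ∀ p : Space n, dist p c ≤ d → c + w ∈ ball (p + w) t := fun p hp => by
        rw [mem_ball, dist_add_right, dist_comm]
        linarith
      have h1 := hpick _ (hm x hxd) _ (hm y hyd)
      have h2 : barrier N l R (d + t) w ≤ 2 * B + J - 2 * N * l * t ^ 2 := by
        have e : 2 * B - 2 * N * l * t ^ 2 - barrier N l R (d + t) w =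
            N * ‖w‖ ^ 2 - N * l * (4 * R * (t - d) + (t - d) ^ 2) := by
          rw [hB]
          unfold barrier
          ring
        have h3 : 4 * R * (t - d) + (t - d) ^ 2 ≤ 5 * R * ε := by
          have : (t - d) ^ 2 ≤ R * ε := by nlinarith
          have : R * (t - d) ≤ R * ε := by gcongr; linarith
          linarith
        have h4 : N * l * (4 * R * (t - d) + (t - d) ^ 2) ≤ N * l * (5 * R * ε) := by gcongr
        have h5 : J = N * l * (5 * R * ε) := by rw [hJ]; ring
        have h6 : 0 ≤ N * ‖w‖ ^ 2 := by positivity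
        linarith
      linarith
    · have h1 : -(ballSup (fun z => -u z) (x + w) t + ballSup u (y + w) t) ≤
          barrier N l R (d - t) w + J + θ := by
        have hc : Continuous fun s => barrier N l R (d - s) w + J + θ := by
          unfold barrier
          fun_prop
        -- The balls are open, so only pulls by `s < t` are admissible; the full step is reached as
        -- `s → t`.
        refine ge_of_tendsto ((hc.tendsto t).mono_left nhdsWithin_le_nhds)
          (Filter.eventually_of_mem (Ioo_mem_nhdsLT ht) fun s hs => ?_)
        have hm : ∀ p : Space n, dist p c ≤ d → p + (s / d) • (c - p) + w ∈ ball (p + w) t := by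
          intro p hp
          rw [mem_ball, dist_add_right, dist_eq_norm, add_sub_cancel_left, norm_smul,
            Real.norm_of_nonneg (by have := hs.1; positivity), ← dist_eq_norm, dist_comm]
          calc s / d * dist p c ≤ s / d * d := by have := hs.1; gcongr
            _ = s := by field_simp
            _ < t := hs.2
        refine (hpick _ (hm x hxd) _ (hm y hyd)).trans ?_
        exact ih _ _ w (d - s) (dist_lineMap_target_le hxd (hs.2.le.trans hdt) hdpos)
          (dist_lineMap_target_le hyd (hs.2.le.trans hdt) hdpos) (by linarith [hs.1]) hw
      have e : barrier N l R (d + t) w + barrier N l R (d - t) w = 2 * B - 2 * N * l * t ^ 2 := by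
        rw [hB]
        unfold barrier
        ring
      linarith
  have i1 := integrable_ballSup huK (x + w) (stepLaw ε)
  have i2 := integrable_ballSup hnegK (y + w) (stepLaw ε)
  have i3 := integrable_ballSup hnegK (x + w) (stepLaw ε)
  have i4 := integrable_ballSup huK (y + w) (stepLaw ε)
  have i12 : Integrable (fun t => ballSup u (x + w) t + ballSup (fun z => -u z) (y + w) t)
      (stepLaw ε) := i1.add i2
  have i34 : Integrable (fun t => ballSup (fun z => -u z) (x + w) t + ballSup u (y + w) t)
      (stepLaw ε) := i3.add i4
  have htug : ∫ t, (ballSup u (x + w) t + ballSup (fun z => -u z) (y + w) t -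
      (ballSup (fun z => -u z) (x + w) t + ballSup u (y + w) t)) ∂stepLaw ε ≤
      2 * (B + J + θ) - 2 * N * l * (ε ^ 2 / 3) := by
    calc _ ≤ ∫ t, (2 * (B + J + θ) - 2 * N * l * t ^ 2) ∂stepLaw ε := by
          refine integral_mono_ae (i12.sub i34)
            ((integrable_const _).sub ((integrable_sq_stepLaw hε).const_mul _)) ?_
          filter_upwards [ae_stepLaw ε] with t ht
          exact hdown t ht.1 ht.2
      _ = _ := by
          rw [integral_sub (integrable_const _) ((integrable_sq_stepLaw hε).const_mul _),
            integral_const_mul (2 * N * l), integral_sq_stepLaw hε]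
          simp
  rw [integral_sub i12 i34, integral_add i1 i2, integral_add i3 i4] at htug
  have j : ∀ p : Space n, Integrable (fun h => u (p + h)) (ballLaw n ε) := fun p =>
    integrable_of_bound (hu.comp (measurable_const_add p)) fun h => huK _
  obtain ⟨hsq, isq⟩ := integral_norm_add_sq_le w hε
  have hnoise : ∫ h, (u (x + w + h) - u (y + w + h)) ∂ballLaw n ε ≤ B + N * ε ^ 2 + J + θ := by
    have ibar : Integrable (fun h => barrier N l R d (w + h) + (J + θ)) (ballLaw n ε) := by
      unfold barrier
      exact ((isq.add (integrable_const _)).const_mul N).add (integrable_const _)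
    calc _ ≤ ∫ h, (barrier N l R d (w + h) + (J + θ)) ∂ballLaw n ε := by
          refine integral_mono_ae ((j _).sub (j _)) ibar ?_
          filter_upwards [ae_ballLaw n ε] with h hh
          have hh' : ‖h‖ < ε := by simpa using hh
          have := ih x y (w + h) d hxd hyd hd (by linarith [norm_add_le w h])
          rw [← add_assoc, ← add_assoc, add_assoc _ J θ] at this
          exact this
      _ = N * ((∫ h, ‖w + h‖ ^ 2 ∂ballLaw n ε) + l * (4 * R * d - d ^ 2)) + (J + θ) := by
          unfold barrier
          have iq : Integrable (fun h => ‖w + h‖ ^ 2 + l * (4 * R * d - d ^ 2)) (ballLaw n ε) :=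
            isq.add (integrable_const _)
          rw [integral_add (iq.const_mul N) (integrable_const _), integral_const_mul,
            integral_add isq (integrable_const _)]
          simp
      _ ≤ N * ((‖w‖ ^ 2 + ε ^ 2) + l * (4 * R * d - d ^ 2)) + (J + θ) := by gcongr
      _ = _ := by
          rw [hB]
          unfold barrier
          ring
  rw [integral_sub (j _) (j _)] at hnoise
  have hx2 : x + w ∈ ball c (2 * R) := mem_ball.2 ((hmem x hxd).trans_lt (by linarith))
  have hy2 : y + w ∈ ball c (2 * R) := mem_ball.2 ((hmem y hyd).trans_lt (by linarith))
  rw [hdpp _ hx2, hdpp _ hy2]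
  refine le_trans ?_ (add_le_add_right (le_max_left _ _) _)
  -- With `a * l = 6` and mean square step `ε² / 3`, the tug rounds gain `2 N ε²`, while the noise
  -- costs at most `N ε²`. The net gain `N ε²` is what the error `θ` loses.
  have hal : a * l = 6 := by rw [hl]; field_simp
  unfold dppOp
  have h1 := mul_le_mul_of_nonneg_left htug (by linarith : 0 ≤ a / 2)
  have h2 := mul_le_mul_of_nonneg_left hnoise hb
  have h3 : a / 2 * (2 * (B + J + θ) - 2 * N * l * (ε ^ 2 / 3)) =
      a * (B + J + θ) - (a * l) * (N * ε ^ 2) / 3 := by ring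
  rw [h3, hal] at h1
  have h4 : b * (N * ε ^ 2) ≤ N * ε ^ 2 := mul_le_of_le_one_left (by positivity) (by linarith)
  have h5 : a * (B + J + θ) + b * (B + J + θ) = B + J + θ := by rw [← add_mul, hab, one_mul]
  linarith

/-- Starting from the crude error `2K`, each use of `barrier_improve` removes `N ε²`, so finitely
many uses remove it all. Thus `K` affects only the number of iterations, not the bound; the `ε` in
the bound is the overshoot constant `J`. -/
theorem sub_le_barrier (ha : 0 < a) (hb : 0 ≤ b) (hab : a + b = 1) (hu : Measurable u)
    (huK : ∀ x, |u x| ≤ K) {R M : ℝ} (hε : 0 < ε) (hεR : ε ≤ R) {c : Space n}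
    (hdpp : ∀ x ∈ ball c (2 * R), u x = dppOp a b ε u x) (huM : ∀ x ∈ ball c (4 * R), |u x| ≤ M)
    {N : ℝ} (hN : 2 * M ≤ N * R ^ 2) (hN0 : 0 < N) {x y : Space n} {d : ℝ} (hxd : dist x c ≤ d)
    (hyd : dist y c ≤ d) (hd : d < 2 * R) :
    u x - u y ≤ 5 * R * N * (6 / a) * (d + ε) := by
  have hR : 0 < R := hε.trans_le hεR
  have hK : 0 ≤ K := (abs_nonneg _).trans (huK 0)
  set l := 6 / a with hl
  have hl0 : 0 < l := by positivity
  set J := 5 * R * ε * N * l with hJ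
  have hJ0 : 0 < J := by positivity
  have main : ∀ k : ℕ, ∀ x y w : Space n, ∀ d, dist x c ≤ d → dist y c ≤ d → d < 2 * R →
      ‖w‖ < 2 * R → u (x + w) - u (y + w) ≤
        barrier N l R d w + J + max (2 * K - k * (N * ε ^ 2)) 0 := by
    intro k
    induction k with
    | zero =>
      intro x y w d hxd _ hd _
      have h1 := abs_le.1 (huK (x + w))
      have h2 := abs_le.1 (huK (y + w))
      have hd0 : 0 ≤ d := dist_nonneg.trans hxd
      have : 0 ≤ barrier N l R d w := by
        have hq : 0 ≤ 4 * R * d - d ^ 2 := by nlinarith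
        unfold barrier
        positivity
      have := le_max_left (2 * K - (0 : ℕ) * (N * ε ^ 2)) 0
      simp only [Nat.cast_zero, zero_mul, sub_zero] at this ⊢
      linarith
    | succ k ih =>
      intro x y w d hxd hyd hd hw
      refine (barrier_improve ha hb hab hu huK hε hεR hdpp huM hN hN0 hl hJ
        (le_max_right _ _) ih x y w d hxd hyd hd hw).trans ?_
      refine add_le_add_right ?_ _
      have hη : 0 ≤ N * ε ^ 2 := by positivity
      push_cast
      refine max_le ?_ (le_max_right _ _)
      rcases max_cases (2 * K - k * (N * ε ^ 2)) 0 with h | h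
      · rw [h.1]
        refine le_trans (le_of_eq ?_) (le_max_left _ _)
        ring
      · rw [h.1]
        exact le_trans (by linarith) (le_max_right _ _)
  obtain ⟨k, hk⟩ := exists_nat_ge (2 * K / (N * ε ^ 2))
  have hk' : 2 * K - k * (N * ε ^ 2) ≤ 0 := by
    rw [div_le_iff₀ (by positivity)] at hk
    linarith
  have := main k x y 0 d hxd hyd hd (by simpa using hR)
  rw [max_eq_right hk'] at this
  simp only [add_zero, barrier, norm_zero] at this
  have hd0 : 0 ≤ d := dist_nonneg.trans hxd
  have h1 : N * (0 ^ 2 + l * (4 * R * d - d ^ 2)) ≤ N * (l * (5 * R * d)) := by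
    rw [zero_pow two_ne_zero, zero_add]
    gcongr
    nlinarith
  calc u x - u y ≤ N * (l * (5 * R * d)) + J := by linarith
    _ = _ := by rw [hJ]; ring

/-- The target is the midpoint of `x` and `y`, with `R = r / 2`, `d = dist x y / 2` and `N = (2M +
1) / R²`; the `+ 1` keeps `N` positive when `M = 0`. If `ε` or `dist x y` is comparable with `r`,
the bound `2M` is enough. -/
theorem abs_sub_le_of_dpp (ha : 0 < a) (hb : 0 ≤ b) (hab : a + b = 1) (hu : Measurable u)
    (huK : ∀ x, |u x| ≤ K) {r M : ℝ} (hε : 0 < ε) (hr : 0 < r) (hM : 0 ≤ M) {z₀ : Space n}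
    (hdpp : ∀ x ∈ ball z₀ (5 * r), u x = dppOp a b ε u x)
    (huM : ∀ x ∈ ball z₀ (5 * r), |u x| ≤ M) {x y : Space n}
    (hx : x ∈ ball z₀ (3 * r)) (hy : y ∈ ball z₀ (3 * r)) :
    |u x - u y| ≤ 60 * (2 * M + 1) / (a * r) * (dist x y + ε) := by
  have ha1 : a ≤ 1 := by linarith
  by_cases htriv : ε ≤ r / 2 ∧ dist x y < 2 * r
  · obtain ⟨hεr, hxy⟩ := htriv
    set c := midpoint ℝ x y with hc
    have hc3 : c ∈ ball z₀ (3 * r) := (convex_ball z₀ (3 * r)).midpoint_mem hx hy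
    have hsub : ∀ s, s ≤ 2 * r → ball c s ⊆ ball z₀ (5 * r) := fun s hs =>
      ball_subset_ball' (by linarith [mem_ball.1 hc3])
    have hxc : dist x c = dist x y / 2 := by
      rw [hc, dist_left_midpoint, Real.norm_ofNat]
      ring
    have hyc : dist y c = dist x y / 2 := by
      rw [hc, dist_right_midpoint, Real.norm_ofNat]
      ring
    have hN : 2 * M ≤ (2 * M + 1) / (r / 2) ^ 2 * (r / 2) ^ 2 := by
      rw [div_mul_cancel₀ _ (by positivity)]
      linarith
    have key : ∀ p q : Space n, dist p c = dist x y / 2 → dist q c = dist x y / 2 →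
        u p - u q ≤ 60 * (2 * M + 1) / (a * r) * (dist x y + ε) := fun p q hp hq => by
      have := sub_le_barrier ha hb hab hu huK hε hεr (c := c)
        (fun z hz => hdpp z (hsub _ (by linarith) hz))
        (fun z hz => huM z (hsub _ (by linarith) hz)) hN (by positivity) hp.le hq.le (by linarith)
      have e : 5 * (r / 2) * ((2 * M + 1) / (r / 2) ^ 2) * (6 / a) =
          60 * (2 * M + 1) / (a * r) := by
        field_simp
        ring
      rw [e] at this
      refine this.trans ?_
      gcongr
      linarith [dist_nonneg (x := x) (y := y)]
    rw [abs_le]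
    exact ⟨by linarith [key y x hyc hxc], key x y hxc hyc⟩
  · have hxy := dist_nonneg (x := x) (y := y)
    have h1 : r / 2 ≤ dist x y + ε := by
      by_contra! hcon
      exact htriv ⟨by linarith, by linarith⟩
    have hb3 : ball z₀ (3 * r) ⊆ ball z₀ (5 * r) := ball_subset_ball (by linarith)
    have hx' := abs_le.1 (huM x (hb3 hx))
    have hy' := abs_le.1 (huM y (hb3 hy))
    have h2 : 60 * (2 * M + 1) / (a * r) * (r / 2) ≤
        60 * (2 * M + 1) / (a * r) * (dist x y + ε) := by gcongr
    have h3 : 60 * (2 * M + 1) / (a * r) * (r / 2) = 30 * (2 * M + 1) / a := by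
      field_simp
      ring
    have h4 : 30 * (2 * M + 1) ≤ 30 * (2 * M + 1) / a := by
      rw [le_div_iff₀ ha]
      exact mul_le_of_le_one_right (by positivity) ha1
    rw [abs_le]
    constructor <;> linarith

theorem abs_sub_le_mul_dist_of_dpp (ha : 0 < a) (hb : 0 ≤ b) (hab : a + b = 1) (hu : Measurable u)
    (huK : ∀ x, |u x| ≤ K) {r M : ℝ} (hε : 0 < ε) (hr : ε < r) (hM : 0 ≤ M) {z₀ : Space n}
    (hdpp : ∀ x ∈ ball z₀ (5 * r), u x = dppOp a b ε u x)
    (huM : ∀ x ∈ ball z₀ (5 * r), |u x| ≤ M) {x y : Space n}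
    (hx : x ∈ ball z₀ (2 * r)) (hy : y ∈ ball z₀ (2 * r)) :
    |u x - u y| ≤ (8 * (n + 1)) * (60 * (2 * M + 1) / (a * r)) * dist x y := by
  have hr0 : 0 < r := hε.trans hr
  set A := 60 * (2 * M + 1) / (a * r) with hA
  have hA0 : 0 < A := by positivity
  have hasym : ∀ p ∈ ball z₀ (3 * r), ∀ q ∈ ball z₀ (3 * r), |u p - u q| ≤ A * (dist p q + ε) :=
    fun p hp q hq => abs_sub_le_of_dpp ha hb hab hu huK hε hr0 hM hdpp huM hp hq
  have h23 : ball z₀ (2 * r) ⊆ ball z₀ (3 * r) := ball_subset_ball (by linarith)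
  have h25 : ball z₀ (2 * r) ⊆ ball z₀ (5 * r) := ball_subset_ball (by linarith)
  rcases lt_or_ge (dist x y) ε with hxy | hxy
  · rw [hdpp x (h25 hx), hdpp y (h25 hy)]
    -- Points of either ball are within `2ε` of `x`, so there `u` differs from `u x` by at most `A
    -- (2ε + ε)`. The oscillation `6 A ε` absorbs the `1 / ε` of the smoothing estimate.
    refine (abs_dppOp_sub_le ha.le hb hab hu huK hxy (c := u x - 3 * A * ε) (O := 6 * A * ε)
      fun z hz => ?_).trans ?_
    · have hz3 : z ∈ ball z₀ (3 * r) := by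
        rcases hz with hz | hz
        · exact ball_subset_ball' (by linarith [mem_ball.1 hx]) hz
        · exact ball_subset_ball' (by linarith [mem_ball.1 hy]) hz
      have hzx : dist z x ≤ 2 * ε := by
        rcases hz with hz | hz
        · linarith [mem_ball.1 hz]
        · linarith [mem_ball.1 hz, dist_triangle z y x, dist_comm x y]
      have h1 := hasym z hz3 x (h23 hx)
      have h2 : A * (dist z x + ε) ≤ 3 * A * ε := by nlinarith
      have h3 := abs_le.1 (h1.trans h2)
      constructor <;> linarith
    · have e : (n + 1) * (6 * A * ε) / ε * dist x y = (6 * (n + 1)) * A * dist x y := by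
        field_simp
      rw [e]
      gcongr
      norm_num
  · refine (hasym x (h23 hx) y (h23 hy)).trans ?_
    have hn : (0 : ℝ) ≤ n := Nat.cast_nonneg n
    have : A * (dist x y + ε) ≤ 2 * (A * dist x y) := by nlinarith
    refine this.trans ?_
    have h0 : 0 ≤ A * dist x y := by positivity
    nlinarith

end Barrier

/-! ### Stopped trajectories -/

section Trajectories

variable {n : ℕ}

open Classical in
/-- The position of the token at time `k`, stopped when it leaves `Ω`. -/
def stoppedPos (Ω : Set (Space n)) : ℕ → (ℕ → Round n) → Space n
  | 0, ω => (ω 0).pos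
  | k + 1, ω => if stoppedPos Ω k ω ∈ Ω then (ω (k + 1)).pos else stoppedPos Ω k ω

theorem measurable_pos : Measurable (Round.pos : Round n → Space n) := by
  unfold Round.pos
  fun_prop

theorem measurable_current (k : ℕ) : Measurable (History.current : History n k → Space n) := by
  unfold History.current Round.pos
  fun_prop

theorem measurable_stoppedPos {Ω : Set (Space n)} (hΩ : MeasurableSet Ω) (k : ℕ) :
    Measurable (stoppedPos Ω k) := by
  induction k with
  | zero => exact measurable_pos.comp (measurable_pi_apply 0)
  | succ k ih =>
    exact Measurable.ite (ih hΩ) (measurable_pos.comp (measurable_pi_apply (k + 1))) ih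

theorem stoppedPos_eq_pos {Ω : Set (Space n)} {k : ℕ} {ω : ℕ → Round n}
    (h : stoppedPos Ω k ω ∈ Ω) : stoppedPos Ω k ω = (ω k).pos := by
  cases k with
  | zero => rfl
  | succ k =>
    rw [stoppedPos] at h ⊢
    split_ifs at h ⊢ with h'
    · rfl
    · exact absurd h h'

theorem stoppedPos_congr {Ω : Set (Space n)} {k : ℕ} {ω ω' : ℕ → Round n}
    (h : ∀ i ≤ k, ω i = ω' i) : stoppedPos Ω k ω = stoppedPos Ω k ω' := by
  induction k with
  | zero => simp [stoppedPos, h 0 le_rfl]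
  | succ k ih =>
    rw [stoppedPos, stoppedPos, ih fun i hi => h i (by omega), h (k + 1) le_rfl]

theorem stoppedPos_of_notMem {Ω : Set (Space n)} {k : ℕ} {ω : ℕ → Round n}
    (h : stoppedPos Ω k ω ∉ Ω) {j : ℕ} (hj : k ≤ j) : stoppedPos Ω j ω = stoppedPos Ω k ω := by
  induction j, hj using Nat.le_induction with
  | base => rfl
  | succ j _ ih => rw [stoppedPos, ih, if_neg h]

theorem payoff_eq_of_stoppedPos_notMem {Ω : Set (Space n)} (F : Space n → ℝ) {k : ℕ}
    {ω : ℕ → Round n} (h : stoppedPos Ω k ω ∉ Ω) : payoff Ω F ω = F (stoppedPos Ω k ω) := by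
  classical
  have key : ∀ k, stoppedPos Ω k ω ∉ Ω → ∃ j, stoppedPos Ω k ω = (ω j).pos ∧ (ω j).pos ∉ Ω ∧
      ∀ i < j, (ω i).pos ∈ Ω := by
    intro k
    induction k with
    | zero => exact fun h => ⟨0, rfl, h, by simp⟩
    | succ k ih =>
      intro h
      by_cases h' : stoppedPos Ω k ω ∈ Ω
      · have e : stoppedPos Ω (k + 1) ω = (ω (k + 1)).pos := by rw [stoppedPos, if_pos h']
        refine ⟨k + 1, e, e ▸ h, fun i hi => ?_⟩
        have hi' : stoppedPos Ω i ω ∈ Ω := by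
          by_contra hcon
          rw [stoppedPos_of_notMem hcon (Nat.lt_succ_iff.1 hi)] at h'
          exact hcon h'
        rw [← stoppedPos_eq_pos hi']
        exact hi'
      · rw [stoppedPos_of_notMem h' k.le_succ]
        exact ih h'
  obtain ⟨j, hj, hjΩ, hlt⟩ := key k h
  have hex : ∃ k, (ω k).pos ∉ Ω := ⟨j, hjΩ⟩
  have hfind : Nat.find hex = j :=
    (Nat.find_eq_iff hex).2 ⟨hjΩ, fun i hi => not_not.2 (hlt i hi)⟩
  rw [payoff, dif_pos hex, hj]
  congr 3

/-- A trajectory that extends a given history. -/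
def extendHistory {k : ℕ} (h : History n k) (i : ℕ) : Round n :=
  if hi : i ∈ Finset.Iic k then h ⟨i, hi⟩ else 0

theorem measurable_extendHistory (k : ℕ) :
    Measurable (extendHistory : History n k → ℕ → Round n) := by
  refine measurable_pi_lambda _ fun i => ?_
  by_cases hi : i ∈ Finset.Iic k
  · simpa only [extendHistory, hi, dite_true] using measurable_pi_apply _
  · simpa only [extendHistory, hi, dite_false] using measurable_const

theorem extendHistory_frestrictLe {k i : ℕ} (hi : i ≤ k) (ω : ℕ → Round n) :
    extendHistory (Preorder.frestrictLe (π := fun _ => Round n) k ω) i = ω i := by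
  simp [extendHistory, hi]

theorem current_frestrictLe (k : ℕ) (ω : ℕ → Round n) :
    History.current (Preorder.frestrictLe (π := fun _ => Round n) k ω) = (ω k).pos := rfl

end Trajectories

/-! ### One-step expectations, termination and optional stopping -/

section GameLaw

variable {n : ℕ} {p ε : ℝ} (hp : 2 < p) (hε : 0 < ε) (SI SII : Strategy n)

instance isProbabilityMeasure_gameLaw (x₀ : Space n) :
    IsProbabilityMeasure (gameLaw hp hε SI SII x₀) := by
  unfold gameLaw
  infer_instance

theorem noiseProb_nonneg (n : ℕ) (hp : 2 < p) : 0 ≤ noiseProb n p := by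
  unfold noiseProb
  positivity

theorem noiseProb_pos (n : ℕ) (hp : 2 < p) : 0 < noiseProb n p := by
  unfold noiseProb
  positivity

theorem tugProb_pos (n : ℕ) (hp : 2 < p) : 0 < tugProb n p := by
  unfold tugProb
  have : 0 < p - 2 := by linarith
  positivity

theorem tugProb_add_noiseProb (n : ℕ) (hp : 2 < p) : tugProb n p + noiseProb n p = 1 := by
  have hpn : (p + n : ℝ) ≠ 0 := by positivity
  unfold noiseProb tugProb
  rw [add_comm (n : ℝ) p]
  field_simp
  ring

theorem integral_nextRound (hp : 2 < p) (hε : 0 < ε) (SI SII : Strategy n) {f : Space n → ℝ} (hf : Measurable f) {K : ℝ} (hK : ∀ x, |f x| ≤ K)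
    {k : ℕ} (h : History n k) :
    ∫ w, f (nextRound SI SII h w).pos ∂noiseLaw n p ε =
      tugProb n p / 2 * (∫ t, f (SI.move k (h, t)) ∂stepLaw ε +
        ∫ t, f (SII.move k (h, t)) ∂stepLaw ε) +
      noiseProb n p * ∫ y, f (h.current + y) ∂ballLaw n ε := by
  have := isProbabilityMeasure_coinLaw n hp
  have := isProbabilityMeasure_stepLaw hε
  have := isProbabilityMeasure_ballLaw n hε
  have hm : Measurable fun w => f (nextRound SI SII h w).pos :=
    hf.comp (measurable_pos.comp ((measurable_nextRound SI SII k).comp measurable_prodMk_left))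
  have hi : ∀ (μ : Measure (Fin 3 × ℝ × Space n)) [IsFiniteMeasure μ],
      Integrable (fun w => f (nextRound SI SII h w).pos) μ := fun μ _ =>
    integrable_of_bound hm fun w => hK _
  rw [noiseLaw, integral_prod _ (hi _)]
  have hc : ∀ (g : Fin 3 → ℝ), ∫ c, g c ∂coinLaw n p =
      noiseProb n p * g 0 + (tugProb n p / 2 * g 1 + tugProb n p / 2 * g 2) := by
    intro g
    have hg : ∀ (a : ℝ) (c : Fin 3),
        Integrable g (ENNReal.ofReal a • Measure.dirac c) := fun a c =>
      (integrable_dirac (by simp)).smul_measure ENNReal.ofReal_ne_top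
    have ht : 0 ≤ tugProb n p / 2 := by have := tugProb_pos n hp; positivity
    rw [coinLaw, integral_add_measure (hg _ _) ((hg _ _).add_measure (hg _ _)),
      integral_add_measure (hg _ _) (hg _ _), integral_smul_measure, integral_smul_measure,
      integral_smul_measure, integral_dirac, integral_dirac, integral_dirac,
      ENNReal.toReal_ofReal ht, ENNReal.toReal_ofReal (noiseProb_nonneg n hp)]
    simp
  rw [hc]
  have h0 : ∫ y, f (nextRound SI SII h (0, y)).pos ∂(stepLaw ε).prod (ballLaw n ε) =
      ∫ y, f (h.current + y) ∂ballLaw n ε := by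
    have := integral_fun_snd (μ := stepLaw ε) (ν := ballLaw n ε) fun y => f (h.current + y)
    simpa [nextRound, Round.pos] using this
  have h1 : ∫ y, f (nextRound SI SII h (1, y)).pos ∂(stepLaw ε).prod (ballLaw n ε) =
      ∫ t, f (SI.move k (h, t)) ∂stepLaw ε := by
    have := integral_fun_fst (μ := stepLaw ε) (ν := ballLaw n ε) fun t => f (SI.move k (h, t))
    simpa [nextRound, Round.pos] using this
  have h2 : ∫ y, f (nextRound SI SII h (2, y)).pos ∂(stepLaw ε).prod (ballLaw n ε) =
      ∫ t, f (SII.move k (h, t)) ∂stepLaw ε := by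
    have := integral_fun_fst (μ := stepLaw ε) (ν := ballLaw n ε) fun t => f (SII.move k (h, t))
    simpa [nextRound, Round.pos] using this
  rw [h0, h1, h2]
  ring

-- `g` plays the role of the conditional expectation of `f (stoppedPos Ω (k + 1))` given the first
-- `k` rounds. The identity comes from disintegrating the trajectory law into its first `k` rounds
-- and the step kernel.
open Classical in
theorem integral_stoppedPos_succ {Ω : Set (Space n)} (hΩ : MeasurableSet Ω) (x₀ : Space n)
    {f : Space n → ℝ} (hf : Measurable f) {K : ℝ} (hK : ∀ x, |f x| ≤ K) (k : ℕ) :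
    ∃ g : (ℕ → Round n) → ℝ, Measurable g ∧ (∀ ω, |g ω| ≤ K) ∧
      (∀ ω, stoppedPos Ω k ω ∈ Ω → g ω = ∫ w, f (nextRound SI SII
        (Preorder.frestrictLe (π := fun _ => Round n) k ω) w).pos ∂noiseLaw n p ε) ∧
      (∀ ω, stoppedPos Ω k ω ∉ Ω → g ω = f (stoppedPos Ω k ω)) ∧
      ∫ ω, f (stoppedPos Ω (k + 1) ω) ∂gameLaw hp hε SI SII x₀ =
        ∫ ω, g ω ∂gameLaw hp hε SI SII x₀ := by
  have := isProbabilityMeasure_noiseLaw n hp hε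
  -- The stopped position at time `k` depends only on entries up to `k`, so the zero padding of the
  -- history is harmless.
  let Y : History n k → Space n := fun h => stoppedPos Ω k (extendHistory h)
  have hY : Measurable Y := (measurable_stoppedPos hΩ k).comp (measurable_extendHistory k)
  have hYω : ∀ ω, Y (Preorder.frestrictLe (π := fun _ => Round n) k ω) = stoppedPos Ω k ω :=
    fun ω => stoppedPos_congr fun i hi => extendHistory_frestrictLe hi ω
  let Φ : History n k × Round n → ℝ := fun q => if Y q.1 ∈ Ω then f q.2.pos else f (Y q.1)
  have hΦ : Measurable Φ := Measurable.ite ((hY.comp measurable_fst) hΩ)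
    (hf.comp (measurable_pos.comp measurable_snd)) (hf.comp (hY.comp measurable_fst))
  have hΦK : ∀ q, |Φ q| ≤ K := fun q => by
    by_cases hq : Y q.1 ∈ Ω
    · simpa only [Φ, hq, if_true] using hK _
    · simpa only [Φ, hq, if_false] using hK _
  let κ := stepKernel hp hε SI SII
  let G : History n k → ℝ := fun h => ∫ z, Φ (h, z) ∂κ k h
  have hG : Measurable G :=
    (hΦ.stronglyMeasurable.integral_kernel_prod_right' (κ := κ k)).measurable
  have hfr : Measurable (Preorder.frestrictLe (π := fun _ => Round n) k) :=
    Preorder.measurable_frestrictLe k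
  refine ⟨fun ω => G (Preorder.frestrictLe (π := fun _ => Round n) k ω), hG.comp hfr,
    fun ω => abs_integral_le_of_bound fun z => hΦK _, fun ω hω => ?_, fun ω hω => ?_, ?_⟩
  · have hω' : Y (Preorder.frestrictLe (π := fun _ => Round n) k ω) ∈ Ω := by rwa [hYω]
    simp only [G, Φ, hω', if_true]
    exact integral_map ((measurable_nextRound SI SII k).comp measurable_prodMk_left).aemeasurable
      (hf.comp measurable_pos).aestronglyMeasurable
  · have hω' : Y (Preorder.frestrictLe (π := fun _ => Round n) k ω) ∉ Ω := by rwa [hYω]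
    simp only [G, Φ, hω', if_false, integral_const, probReal_univ, one_smul]
    rw [hYω]
  · have e : ∀ ω, f (stoppedPos Ω (k + 1) ω) =
        Φ (Preorder.frestrictLe (π := fun _ => Round n) k ω, ω (k + 1)) := fun ω => by
      simp only [Φ, hYω, stoppedPos]
      split_ifs <;> rfl
    simp only [e]
    have h1 := Kernel.partialTraj_compProd_eq_map_traj (X := fun _ => Round n) (κ := κ)
      (Nat.zero_le k) (x₀ := fun _ => ((0, 0, x₀) : Round n))
    have hpair : Measurable fun ω : ℕ → Round n =>
        (Preorder.frestrictLe (π := fun _ => Round n) k ω, ω (k + 1)) :=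
      hfr.prodMk (measurable_pi_apply _)
    have h2 := integral_map (μ := gameLaw hp hε SI SII x₀) hpair.aemeasurable
      hΦ.aestronglyMeasurable
    rw [← h2]
    have h3 := Kernel.traj_map_frestrictLe_apply (X := fun _ => Round n) (κ := κ) 0 k
      fun _ => ((0, 0, x₀) : Round n)
    have h4 := integral_map (μ := gameLaw hp hε SI SII x₀) hfr.aemeasurable
      hG.aestronglyMeasurable
    rw [← h4]
    unfold gameLaw
    rw [← h1, h3, Measure.integral_compProd]
    exact integrable_of_bound hΦ hΦK

theorem ae_stoppedPos_zero (Ω : Set (Space n)) (x₀ : Space n) :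
    ∀ᵐ ω ∂gameLaw hp hε SI SII x₀, stoppedPos Ω 0 ω = x₀ := by
  have h3 := Kernel.traj_map_frestrictLe_apply (X := fun _ => Round n)
    (κ := stepKernel hp hε SI SII) 0 0 fun _ => ((0, 0, x₀) : Round n)
  rw [Kernel.partialTraj_self, Kernel.id_apply] at h3
  have hfr : Measurable (Preorder.frestrictLe (π := fun _ => Round n) 0) :=
    Preorder.measurable_frestrictLe 0
  have h4 : ∀ᵐ h ∂(gameLaw hp hε SI SII x₀).map (Preorder.frestrictLe (π := fun _ => Round n) 0),
      History.current (k := 0) h = x₀ := by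
    unfold gameLaw
    rw [h3]
    exact (ae_dirac_iff ((measurable_current 0) (measurableSet_singleton x₀))).2 rfl
  exact ae_of_ae_map hfr.aemeasurable h4

/-- The drift `c` acts only while the token is in `Ω`. A positive `c` serves to prove termination, a
negative one to account for errors in near-optimal play. -/
theorem add_le_integral_stoppedPos_succ {Ω : Set (Space n)} (hΩ : MeasurableSet Ω) (x₀ : Space n)
    {f : Space n → ℝ} (hf : Measurable f) {K : ℝ} (hK : ∀ x, |f x| ≤ K) {k : ℕ} {c : ℝ}
    (hstep : ∀ h : History n k, h.current ∈ Ω →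
      f h.current + c ≤ ∫ w, f (nextRound SI SII h w).pos ∂noiseLaw n p ε) :
    ∫ ω, f (stoppedPos Ω k ω) ∂gameLaw hp hε SI SII x₀ +
      c * (gameLaw hp hε SI SII x₀).real {ω | stoppedPos Ω k ω ∈ Ω} ≤
      ∫ ω, f (stoppedPos Ω (k + 1) ω) ∂gameLaw hp hε SI SII x₀ := by
  obtain ⟨g, hg, hgK, hin, hout, he⟩ := integral_stoppedPos_succ hp hε SI SII hΩ x₀ hf hK k
  have hA : MeasurableSet {ω | stoppedPos Ω k ω ∈ Ω} := measurable_stoppedPos hΩ k hΩ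
  have i1 : Integrable (fun ω => f (stoppedPos Ω k ω)) (gameLaw hp hε SI SII x₀) :=
    integrable_of_bound (hf.comp (measurable_stoppedPos hΩ k)) fun ω => hK _
  have i2 : Integrable ({ω | stoppedPos Ω k ω ∈ Ω}.indicator fun _ => c)
      (gameLaw hp hε SI SII x₀) := (integrable_const c).indicator hA
  have e : c * (gameLaw hp hε SI SII x₀).real {ω | stoppedPos Ω k ω ∈ Ω} =
      ∫ ω, {ω | stoppedPos Ω k ω ∈ Ω}.indicator (fun _ => c) ω ∂gameLaw hp hε SI SII x₀ := by
    rw [integral_indicator_const _ hA, smul_eq_mul, mul_comm]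
  rw [he, e, ← integral_add i1 i2]
  refine integral_mono (i1.add i2) (integrable_of_bound hg hgK) fun ω => ?_
  by_cases hω : stoppedPos Ω k ω ∈ Ω
  · have hcur := stoppedPos_eq_pos hω
    have := hstep (Preorder.frestrictLe (π := fun _ => Round n) k ω)
      (by rwa [current_frestrictLe, ← hcur])
    rw [current_frestrictLe, ← hcur] at this
    rw [hin ω hω]
    simpa [hω] using this
  · simp [hω, hout ω hω]

/-- By connectedness, the segment from `y` to `x` meets the frontier. -/
theorem mem_strip_of_dist_lt {Ω : Set (Space n)} {x y : Space n} (hx : x ∈ Ω) (hy : y ∉ Ω)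
    {s : ℝ} (hxy : dist y x ≤ s) : y ∈ strip Ω s := by
  refine ⟨hy, ?_⟩
  obtain ⟨z, hz, hzf⟩ : ∃ z ∈ segment ℝ y x, z ∈ frontier Ω := by
    by_contra! hcon
    have hcov : ∀ z ∈ segment ℝ y x, z ∈ closure Ω → z ∈ interior Ω := fun z hz hzc => by
      by_contra hzi
      exact hcon z hz ⟨hzc, hzi⟩
    have hyc : y ∉ closure Ω := fun h =>
      hy (interior_subset (hcov y (left_mem_segment ℝ y x) h))
    obtain ⟨z, -, hz1, hz2⟩ := (convex_segment (𝕜 := ℝ) y x).isPreconnected (interior Ω)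
      (closure Ω)ᶜ isOpen_interior isClosed_closure.isOpen_compl
      (fun z hz => (em (z ∈ closure Ω)).imp (hcov z hz) id)
      ⟨x, right_mem_segment ℝ y x, hcov x (right_mem_segment ℝ y x) (subset_closure hx)⟩
      ⟨y, left_mem_segment ℝ y x, hyc⟩
    exact hz2 (interior_subset_closure hz1)
  have h1 := infDist_le_dist_of_mem (x := y) hzf
  have h2 := dist_add_dist_of_mem_segment hz
  linarith [dist_nonneg (x := z) (y := x)]

theorem measurableSet_strip {Ω : Set (Space n)} (hΩ : MeasurableSet Ω) (s : ℝ) :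
    MeasurableSet (strip Ω s) :=
  hΩ.compl.inter (measurableSet_le (continuous_infDist_pt _).measurable measurable_const)

theorem ae_stoppedPos_mem {Ω : Set (Space n)} (hΩ : MeasurableSet Ω) {x₀ : Space n}
    (hx₀ : x₀ ∈ Ω ∪ strip Ω ε) :
    ∀ᵐ ω ∂gameLaw hp hε SI SII x₀, ∀ k, stoppedPos Ω k ω ∈ Ω ∪ strip Ω ε := by
  rw [ae_all_iff]
  intro k
  have hS : MeasurableSet (Ω ∪ strip Ω ε) := hΩ.union (measurableSet_strip hΩ ε)
  induction k with
  | zero =>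
    filter_upwards [ae_stoppedPos_zero hp hε SI SII Ω x₀] with ω hω
    rwa [hω]
  | succ k ih =>
    let f : Space n → ℝ := (Ω ∪ strip Ω ε)ᶜ.indicator fun _ => 1
    have hf : Measurable f := measurable_const.indicator hS.compl
    have hf0 : ∀ x, 0 ≤ f x := fun x => Set.indicator_nonneg (fun _ _ => zero_le_one) x
    have hf1 : ∀ x, |f x| ≤ 1 := fun x => by
      rw [abs_of_nonneg (hf0 x)]
      exact Set.indicator_le' (fun _ _ => le_rfl) (fun _ _ => zero_le_one) x
    have hfS : ∀ x ∈ Ω, ∀ y, dist y x < ε → f y = 0 := by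
      intro x hx y hy
      have : y ∈ Ω ∪ strip Ω ε := by
        by_cases h : y ∈ Ω
        · exact .inl h
        · exact .inr (mem_strip_of_dist_lt hx h hy.le)
      simp only [f, Set.indicator, Set.mem_compl_iff, this, not_true_eq_false, if_false]
    obtain ⟨g, hg, hgK, hin, hout, he⟩ := integral_stoppedPos_succ hp hε SI SII hΩ x₀ hf hf1 k
    have hg0 : ∫ ω, g ω ∂gameLaw hp hε SI SII x₀ = 0 := by
      refine integral_eq_zero_of_ae ?_
      filter_upwards [ih] with ω hω
      by_cases hω' : stoppedPos Ω k ω ∈ Ω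
      · rw [hin ω hω', integral_nextRound hp hε SI SII hf hf1]
        have hcur : History.current (Preorder.frestrictLe (π := fun _ => Round n) k ω) ∈ Ω := by
          rwa [current_frestrictLe, ← stoppedPos_eq_pos hω']
        have hmove : ∀ S : Strategy n, ∫ t, f (S.move k
            (Preorder.frestrictLe (π := fun _ => Round n) k ω, t)) ∂stepLaw ε = 0 := fun S => by
          refine integral_eq_zero_of_ae ?_
          filter_upwards [ae_stepLaw ε] with t ht
          exact hfS _ hcur _ ((mem_ball.1 (S.move_mem k _ t ht.1)).trans_le ht.2)
        have hball : ∫ y, f (History.current (Preorder.frestrictLe (π := fun _ => Round n) k ω) + y)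
            ∂ballLaw n ε = 0 := by
          refine integral_eq_zero_of_ae ?_
          filter_upwards [ae_ballLaw n ε] with y hy
          exact hfS _ hcur _ (by simpa [dist_eq_norm] using hy)
        simp [hmove, hball]
      · rw [hout ω hω']
        simp only [f, Set.indicator, Set.mem_compl_iff, hω, not_true_eq_false, if_false]
        rfl
    have hi : Integrable (fun ω => f (stoppedPos Ω (k + 1) ω)) (gameLaw hp hε SI SII x₀) :=
      integrable_of_bound (hf.comp (measurable_stoppedPos hΩ (k + 1))) fun ω => hf1 _
    rw [hg0, integral_eq_zero_iff_of_nonneg (fun ω => hf0 _) hi] at he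
    filter_upwards [he] with ω hω
    by_contra hcon
    simp only [f, Set.indicator, Set.mem_compl_iff, hcon, not_false_eq_true, if_true,
      Pi.zero_apply, one_ne_zero] at hω

theorem measureReal_ballLaw_halfSpace_pos (hε : 0 < ε) (i : Fin n) :
    0 < (ballLaw n ε).real {y | ε / 2 < y i} := by
  have := isProbabilityMeasure_ballLaw n hε
  have hopen : IsOpen (ball (0 : Space n) ε ∩ {y | ε / 2 < y i}) :=
    isOpen_ball.inter (isOpen_lt continuous_const (by fun_prop))
  have hne : (ball (0 : Space n) ε ∩ {y | ε / 2 < y i}).Nonempty := by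
    refine ⟨EuclideanSpace.single i (3 / 4 * ε), ?_, ?_⟩
    · rw [mem_ball_zero_iff, PiLp.norm_single, Real.norm_of_nonneg (by positivity)]
      linarith
    · simp only [Set.mem_ofPred_eq, PiLp.single_apply, if_true]
      linarith
  refine ENNReal.toReal_pos ?_ (measure_ne_top _ _)
  rw [ballLaw, cond_apply measurableSet_ball]
  exact mul_ne_zero (ENNReal.inv_ne_zero.2 measure_ball_lt_top.ne)
    (hopen.measure_pos volume hne).ne'

/-- An exponential of one coordinate is positive, and the noise alone at least doubles its mean
whatever the players do. Truncated, it stays bounded, yet its mean grows by a fixed multiple of the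
survival probability each round; so survival forever has probability zero. -/
theorem ae_exists_stoppedPos_notMem (hn : 0 < n) {Ω : Set (Space n)} (hΩ : MeasurableSet Ω)
    (hbdd : Bornology.IsBounded Ω) (x₀ : Space n) :
    ∀ᵐ ω ∂gameLaw hp hε SI SII x₀, ∃ k, stoppedPos Ω k ω ∉ Ω := by
  have := isProbabilityMeasure_ballLaw n hε
  let i : Fin n := ⟨0, hn⟩
  obtain ⟨ρ', hρ'⟩ := hbdd.subset_closedBall 0
  -- The margin `ε` keeps the truncation inactive for a random move started in `Ω`.
  set ρ := max ρ' 0 + ε with hρ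
  set q := (ballLaw n ε).real {y | ε / 2 < y i} with hq
  have hq0 : 0 < q := measureReal_ballLaw_halfSpace_pos hε i
  have hβ := noiseProb_pos n hp
  have hα := tugProb_pos n hp
  set β := noiseProb n p with hβdef
  -- A displacement above `ε / 2`, of probability `q`, then multiplies the exponential by at least
  -- `2 / (β q)`, since `exp z ≥ z`.
  set c := 2 / ε * (2 / (β * q)) with hc
  have hc0 : 0 < c := by positivity
  let φ : Space n → ℝ := fun x => Real.exp (c * max (-ρ) (min (x i) ρ))
  have hφm : Measurable φ := by
    have : Continuous φ := by fun_prop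
    exact this.measurable
  have hρ0 : 0 < ρ := by positivity
  have hφK : ∀ x, |φ x| ≤ Real.exp (c * ρ) := fun x => by
    rw [abs_of_pos (Real.exp_pos _)]
    exact Real.exp_le_exp.2 (mul_le_mul_of_nonneg_left
      (max_le (by linarith) (min_le_right _ _)) hc0.le)
  set m := Real.exp (c * (-ρ)) with hm
  have hφlow : ∀ x, m ≤ φ x := fun x =>
    Real.exp_le_exp.2 (mul_le_mul_of_nonneg_left (le_max_left _ _) hc0.le)
  have hcoord : ∀ x : Space n, |x i| ≤ ‖x‖ := fun x => PiLp.norm_apply_le x i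
  have hφeq : ∀ x : Space n, ‖x‖ ≤ ρ → φ x = Real.exp (c * x i) := fun x hx => by
    have := abs_le.1 ((hcoord x).trans hx)
    simp only [φ]
    rw [min_eq_left this.2, max_eq_right this.1]
  have hstep : ∀ k (h : History n k), h.current ∈ Ω →
      φ h.current + m ≤ ∫ w, φ (nextRound SI SII h w).pos ∂noiseLaw n p ε := by
    intro k h hcur
    rw [integral_nextRound hp hε SI SII hφm hφK]
    have hpos : ∀ S : Strategy n, 0 ≤ ∫ t, φ (S.move k (h, t)) ∂stepLaw ε := fun S =>
      integral_nonneg fun t => (Real.exp_pos _).le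
    have hnorm : ‖h.current‖ ≤ max ρ' 0 := by
      have := hρ' hcur
      rw [mem_closedBall_zero_iff] at this
      exact this.trans (le_max_left _ _)
    have hS : MeasurableSet {y : Space n | ε / 2 < y i} :=
      (isOpen_lt continuous_const (by fun_prop)).measurableSet
    have hlow : φ h.current * (2 / (β * q)) * q ≤ ∫ y, φ (h.current + y) ∂ballLaw n ε := by
      calc φ h.current * (2 / (β * q)) * q
          = ∫ y, {y : Space n | ε / 2 < y i}.indicator
              (fun _ => φ h.current * (2 / (β * q))) y ∂ballLaw n ε := by
            rw [integral_indicator_const _ hS, smul_eq_mul, mul_comm]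
        _ ≤ _ := by
            refine integral_mono_ae ((integrable_const _).indicator hS)
              (integrable_of_bound (hφm.comp (measurable_const_add _)) fun y => hφK _) ?_
            filter_upwards [ae_ballLaw n ε] with y hy
            rw [mem_ball_zero_iff] at hy
            by_cases hyi : ε / 2 < y i
            · rw [Set.indicator_of_mem (by exact hyi),
                hφeq _ (by linarith), hφeq _ (by linarith [norm_add_le h.current y]),
                PiLp.add_apply, mul_add, Real.exp_add]
              refine mul_le_mul_of_nonneg_left ?_ (Real.exp_pos _).le
              have h1 : 2 / (β * q) ≤ c * y i := by
                calc 2 / (β * q) = c * (ε / 2) := by rw [hc]; field_simp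
                  _ ≤ c * y i := by gcongr
              linarith [Real.add_one_le_exp (c * y i)]
            · rw [Set.indicator_of_notMem (by exact hyi)]
              exact (Real.exp_pos _).le
    have h1 := mul_le_mul_of_nonneg_left hlow hβ.le
    have h2 : β * (φ h.current * (2 / (β * q)) * q) = 2 * φ h.current := by field_simp
    have h3 : 0 ≤ tugProb n p / 2 * (∫ t, φ (SI.move k (h, t)) ∂stepLaw ε +
        ∫ t, φ (SII.move k (h, t)) ∂stepLaw ε) :=
      mul_nonneg (by positivity) (add_nonneg (hpos SI) (hpos SII))
    have h4 := hφlow h.current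
    linarith
  set μ := gameLaw hp hε SI SII x₀ with hμ
  set A := {ω : ℕ → Round n | ∀ k, stoppedPos Ω k ω ∈ Ω} with hA
  have hm0 : 0 < m := Real.exp_pos _
  have hgrow : ∀ k : ℕ, k * (m * μ.real A) ≤ ∫ ω, φ (stoppedPos Ω k ω) ∂μ := by
    intro k
    induction k with
    | zero =>
      simp only [Nat.cast_zero, zero_mul]
      exact integral_nonneg fun ω => (Real.exp_pos _).le
    | succ k ih =>
      have h1 := add_le_integral_stoppedPos_succ hp hε SI SII hΩ x₀ hφm hφK (hstep k)
      have h2 : μ.real A ≤ μ.real {ω | stoppedPos Ω k ω ∈ Ω} :=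
        measureReal_mono fun ω hω => hω k
      have h3 := mul_le_mul_of_nonneg_left h2 hm0.le
      push_cast
      linarith
  have hA0 : μ.real A = 0 := by
    by_contra hne
    have hpos : 0 < m * μ.real A := mul_pos hm0 (measureReal_nonneg.lt_of_ne' hne)
    obtain ⟨k, hk⟩ := exists_nat_gt (Real.exp (c * ρ) / (m * μ.real A))
    rw [div_lt_iff₀ hpos] at hk
    have h1 := (le_abs_self _).trans (abs_integral_le_of_bound (μ := μ)
      (f := fun ω => φ (stoppedPos Ω k ω)) fun ω => hφK _)
    linarith [hgrow k]
  rw [measureReal_eq_zero_iff] at hA0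
  rw [ae_iff]
  simpa [hA] using hA0

/-- A bounded function that grows in the mean, up to summable errors, is at most the expected
payoff. -/
theorem le_expectedPayoff_add (hn : 0 < n) {Ω : Set (Space n)} (hΩ : MeasurableSet Ω)
    (hbdd : Bornology.IsBounded Ω) {F v : Space n → ℝ} (hv : Measurable v) {K : ℝ}
    (hK : ∀ x, |v x| ≤ K) (hvF : ∀ x ∈ strip Ω ε, v x = F x) {δ : ℕ → ℝ} (hδ : ∀ k, 0 ≤ δ k)
    {η : ℝ} (hη : ∀ k, ∑ i ∈ Finset.range k, δ i ≤ η)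
    (hstep : ∀ k (h : History n k), h.current ∈ Ω →
      v h.current - δ k ≤ ∫ w, v (nextRound SI SII h w).pos ∂noiseLaw n p ε)
    {x₀ : Space n} (hx₀ : x₀ ∈ Ω ∪ strip Ω ε) :
    v x₀ ≤ expectedPayoff hp hε Ω F SI SII x₀ + η := by
  set μ := gameLaw hp hε SI SII x₀ with hμ
  have hlow : ∀ k, v x₀ - ∑ i ∈ Finset.range k, δ i ≤ ∫ ω, v (stoppedPos Ω k ω) ∂μ := by
    intro k
    induction k with
    | zero =>
      have : ∫ ω, v (stoppedPos Ω 0 ω) ∂μ = ∫ ω, v x₀ ∂μ := by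
        refine integral_congr_ae ?_
        filter_upwards [ae_stoppedPos_zero hp hε SI SII Ω x₀] with ω hω
        rw [hω]
      simp [this]
    | succ k ih =>
      have h1 := add_le_integral_stoppedPos_succ hp hε SI SII hΩ x₀ hv hK (c := -δ k)
        (fun h hh => by linarith [hstep k h hh])
      have h2 : δ k * μ.real {ω | stoppedPos Ω k ω ∈ Ω} ≤ δ k :=
        mul_le_of_le_one_right (hδ k) measureReal_le_one
      rw [Finset.sum_range_succ]
      linarith
  have hlim : Filter.Tendsto (fun k => ∫ ω, v (stoppedPos Ω k ω) ∂μ) Filter.atTop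
      (nhds (∫ ω, payoff Ω F ω ∂μ)) := by
    refine tendsto_integral_of_dominated_convergence (fun _ => K)
      (fun k => (hv.comp (measurable_stoppedPos hΩ k)).aestronglyMeasurable)
      (integrable_const K) (fun k => ae_of_all _ fun ω => hK _) ?_
    filter_upwards [ae_stoppedPos_mem hp hε SI SII hΩ hx₀,
      ae_exists_stoppedPos_notMem hp hε SI SII hn hΩ hbdd x₀] with ω hmem hex
    obtain ⟨k, hk⟩ := hex
    refine tendsto_const_nhds.congr' ?_
    filter_upwards [Filter.eventually_ge_atTop k] with j hj
    rw [payoff_eq_of_stoppedPos_notMem F hk, stoppedPos_of_notMem hk hj,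
      hvF _ ((hmem k).resolve_left hk)]
  have := ge_of_tendsto' (b := v x₀ - η) hlim fun k => by linarith [hlow k, hη k]
  rw [expectedPayoff]
  linarith

end GameLaw

/-! ### Near-optimal Borel strategies -/

section Strategies

variable {n : ℕ}

/-- Borel selection of near-maximizers over open balls. -/
theorem exists_measurable_near_ballSup {v : Space n → ℝ} {K : ℝ}
    (hK : ∀ x, |v x| ≤ K) {η : ℝ} (hη : 0 < η) :
    ∃ s : Space n × ℝ → Space n, Measurable s ∧
      ∀ x t, 0 < t → s (x, t) ∈ ball x t ∧ ballSup v x t - η ≤ v (s (x, t)) := by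
  classical
  -- As `v` need not be continuous, a dense set of points is not enough; a countable dense subset of
  -- every superlevel set at a rational level lets `D` see the suprema over all open sets.
  have hD : ∃ D : Set (Space n), D.Countable ∧ ∀ y c, c < v y → ∀ U, IsOpen U → y ∈ U →
      ∃ d ∈ D, d ∈ U ∧ c < v d := by
    have h : ∀ q : ℚ, ∃ D ⊆ {y | (q : ℝ) < v y}, D.Countable ∧ {y | (q : ℝ) < v y} ⊆ closure D :=
      fun q => (TopologicalSpace.IsSeparable.of_separableSpace _).exists_countable_dense_subset
    choose D hDs hDc hDd using h
    refine ⟨⋃ q, D q, Set.countable_iUnion hDc, fun y c hc U hU hyU => ?_⟩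
    obtain ⟨q, hq1, hq2⟩ := exists_rat_btwn hc
    obtain ⟨d, hdU, hdD⟩ := mem_closure_iff.1 (hDd q hq2) U hU hyU
    exact ⟨d, Set.mem_iUnion.2 ⟨q, hdD⟩, hdU, hq1.trans (hDs q hdD)⟩
  obtain ⟨D, hDc, hD⟩ := hD
  have hDne : D.Nonempty := by
    obtain ⟨d, hd, -⟩ := hD 0 (v 0 - 1) (by linarith) Set.univ isOpen_univ trivial
    exact ⟨d, hd⟩
  obtain ⟨e, rfl⟩ := hDc.exists_eq_range hDne
  have hD' : ∀ x t y c, y ∈ ball x t → c < v y → ∃ i, e i ∈ ball x t ∧ c < v (e i) := by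
    intro x t y c hy hc
    obtain ⟨_, ⟨i, rfl⟩, h⟩ := hD y c hc (ball x t) isOpen_ball hy
    exact ⟨i, h⟩
  -- The selector takes the first index satisfying `P`; the alternative `q.2 ≤ 0` only makes the
  -- search succeed for empty balls.
  let P : ℕ → Space n × ℝ → Prop := fun i q =>
    q.2 ≤ 0 ∨ (dist (e i) q.1 < q.2 ∧ ∀ j, dist (e j) q.1 < q.2 → v (e j) - η ≤ v (e i))
  have hex : ∀ q, ∃ i, P i q := by
    rintro ⟨x, t⟩
    rcases le_or_gt t 0 with ht | ht
    · exact ⟨0, .inl ht⟩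
    obtain ⟨y, hy, hyη⟩ : ∃ y ∈ ball x t, ballSup v x t - η < v y := by
      by_contra! hcon
      have := ballSup_le ht hcon
      linarith
    obtain ⟨i, hi, hiη⟩ := hD' x t y _ hy hyη
    exact ⟨i, .inr ⟨hi, fun j hj => by linarith [le_ballSup hK (mem_ball.2 hj)]⟩⟩
  have hPm : ∀ i, MeasurableSet {q | P i q} := by
    intro i
    have hd : ∀ j, MeasurableSet {q : Space n × ℝ | dist (e j) q.1 < q.2} := fun j =>
      measurableSet_lt (by fun_prop) measurable_snd
    have hset : {q : Space n × ℝ | ∀ j, dist (e j) q.1 < q.2 → v (e j) - η ≤ v (e i)} =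
        ⋂ j, ({q : Space n × ℝ | dist (e j) q.1 < q.2}ᶜ ∪ {_q | v (e j) - η ≤ v (e i)}) := by
      ext q
      simp only [Set.mem_ofPred_eq, Set.mem_iInter, Set.mem_union, Set.mem_compl_iff,
        imp_iff_not_or]
    have hinter : MeasurableSet
        {q : Space n × ℝ | ∀ j, dist (e j) q.1 < q.2 → v (e j) - η ≤ v (e i)} := by
      rw [hset]
      exact MeasurableSet.iInter fun j => (hd j).compl.union (MeasurableSet.const _)
    exact (measurableSet_le measurable_snd measurable_const).union ((hd i).inter hinter)
  refine ⟨fun q => e (Nat.find (hex q)), Measurable.find (fun i => measurable_const) hPm hex,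
    fun x t ht => ?_⟩
  obtain ⟨h1, h2⟩ := (Nat.find_spec (hex (x, t))).resolve_left ht.not_ge
  refine ⟨h1, ?_⟩
  set i := Nat.find (hex (x, t))
  suffices ballSup v x t ≤ v (e i) + η by linarith
  refine ballSup_le ht fun y hy => ?_
  by_contra! hcon
  obtain ⟨j, hj, hjv⟩ := hD' x t y _ hy hcon
  linarith [h2 j hj]

theorem exists_near_optimal_strategy {v : Space n → ℝ} {K : ℝ}
    (hK : ∀ x, |v x| ≤ K) {δ : ℕ → ℝ} (hδ : ∀ k, 0 < δ k) :
    ∃ S : Strategy n, ∀ k (h : History n k) t, 0 < t →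
      ballSup v h.current t - δ k ≤ v (S.move k (h, t)) := by
  choose s hs hsv using fun k => exists_measurable_near_ballSup hK (hδ k)
  exact ⟨⟨fun k q => s k (q.1.current, q.2),
    fun k => (hs k).comp (((measurable_current k).comp measurable_fst).prodMk measurable_snd),
    fun k h t ht => (hsv k h.current t ht).1⟩, fun k h t ht => (hsv k h.current t ht).2⟩

instance : Nonempty (Strategy n) :=
  ⟨⟨fun _ q => q.1.current, fun k => (measurable_current k).comp measurable_fst,
    fun _ _ _ ht => mem_ball_self ht⟩⟩

/-- The player with strategy `S` loses at most `δ` against the supremum, and the opponent cannot go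
below the infimum. -/
theorem dppOp_sub_le_moves {v : Space n → ℝ} (hv : Measurable v) {K : ℝ} (hK : ∀ x, |v x| ≤ K)
    {p ε δ : ℝ} (hp : 2 < p) (hε : 0 < ε) (hδ : 0 ≤ δ) (S S' : Strategy n) {k : ℕ}
    (h : History n k)
    (hS : ∀ t, 0 < t → ballSup v h.current t - δ ≤ v (S.move k (h, t))) :
    dppOp (tugProb n p) (noiseProb n p) ε v h.current - δ ≤
      tugProb n p / 2 * (∫ t, v (S.move k (h, t)) ∂stepLaw ε +
        ∫ t, v (S'.move k (h, t)) ∂stepLaw ε) +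
      noiseProb n p * ∫ y, v (h.current + y) ∂ballLaw n ε := by
  have := isProbabilityMeasure_stepLaw hε
  have hnegK : ∀ x, |(fun z => -v z) x| ≤ K := by simpa using hK
  have hi : ∀ T : Strategy n, Integrable (fun t => v (T.move k (h, t))) (stepLaw ε) := fun T =>
    integrable_of_bound (hv.comp ((T.measurable_move k).comp measurable_prodMk_left)) fun t => hK _
  have h1 : ∫ t, ballSup v h.current t ∂stepLaw ε - δ ≤ ∫ t, v (S.move k (h, t)) ∂stepLaw ε := by
    have : ∫ t, (ballSup v h.current t - δ) ∂stepLaw ε ≤ ∫ t, v (S.move k (h, t)) ∂stepLaw ε := by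
      refine integral_mono_ae ((integrable_ballSup hK _ _).sub (integrable_const _)) (hi S) ?_
      filter_upwards [ae_stepLaw ε] with t ht
      exact hS t ht.1
    rw [integral_sub (integrable_ballSup hK _ _) (integrable_const _)] at this
    simpa using this
  have h2 : -∫ t, ballSup (fun z => -v z) h.current t ∂stepLaw ε ≤
      ∫ t, v (S'.move k (h, t)) ∂stepLaw ε := by
    rw [← integral_neg]
    refine integral_mono_ae (integrable_ballSup hnegK _ _).neg (hi S') ?_
    filter_upwards [ae_stepLaw ε] with t ht
    have := le_ballSup hnegK (S'.move_mem k h t ht.1)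
    show -_ ≤ _
    linarith
  have ha := tugProb_pos n hp
  have hb := noiseProb_pos n hp
  have hab := tugProb_add_noiseProb n hp
  have h3 := mul_le_mul_of_nonneg_left (add_le_add h1 h2) (by positivity : 0 ≤ tugProb n p / 2)
  have h4 : tugProb n p / 2 * δ ≤ δ := mul_le_of_le_one_left hδ (by linarith)
  unfold dppOp
  linarith

end Strategies

/-! ### The value of the game -/

section Value

variable {n : ℕ} {p ε : ℝ} (hp : 2 < p) (hε : 0 < ε)

theorem payoff_neg (Ω : Set (Space n)) (F : Space n → ℝ) (ω : ℕ → Round n) :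
    payoff Ω (fun x => -F x) ω = -payoff Ω F ω := by
  unfold payoff
  split_ifs <;> simp

theorem expectedPayoff_neg (Ω : Set (Space n)) (F : Space n → ℝ) (SI SII : Strategy n)
    (x₀ : Space n) : expectedPayoff hp hε Ω (fun x => -F x) SI SII x₀ =
      -expectedPayoff hp hε Ω F SI SII x₀ := by
  simp only [expectedPayoff, payoff_neg, integral_neg]

theorem sum_half_pow_le {η : ℝ} (hη : 0 ≤ η) (k : ℕ) :
    ∑ i ∈ Finset.range k, η / 2 * (1 / 2) ^ i ≤ η := by
  rw [← Finset.mul_sum]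
  nlinarith [sum_geometric_two_le k]

variable {Ω : Set (Space n)} {F G v : Space n → ℝ} {K L : ℝ}

theorem exists_strategyI_le_expectedPayoff (hn : 0 < n) (hΩ : MeasurableSet Ω)
    (hbdd : Bornology.IsBounded Ω)
    (hv : IsDppSolution (tugProb n p) (noiseProb n p) ε Ω G v K L)
    (hGF : ∀ x ∈ strip Ω ε, G x = F x) {η : ℝ} (hη : 0 < η) :
    ∃ SI : Strategy n, ∀ SII, ∀ x₀ ∈ Ω ∪ strip Ω ε,
      v x₀ - η ≤ expectedPayoff hp hε Ω F SI SII x₀ := by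
  have hδ : ∀ k : ℕ, 0 < η / 2 * (1 / 2) ^ k := fun k => by positivity
  obtain ⟨SI, hSI⟩ := exists_near_optimal_strategy hv.bound hδ
  refine ⟨SI, fun SII x₀ hx₀ => ?_⟩
  have := le_expectedPayoff_add hp hε SI SII hn hΩ hbdd hv.measurable hv.bound
    (fun x hx => (hv.eq_boundary x hx.1).trans (hGF x hx)) (fun k => (hδ k).le)
    (sum_half_pow_le hη.le) (fun k h hh => ?_) hx₀
  · linarith
  · rw [integral_nextRound hp hε SI SII hv.measurable hv.bound, hv.eq_dppOp _ hh]
    exact dppOp_sub_le_moves hv.measurable hv.bound hp hε (hδ k).le SI SII h (hSI k h)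

theorem IsDppSolution.neg {a b : ℝ} (hv : IsDppSolution a b ε Ω G v K L) :
    IsDppSolution a b ε Ω (fun x => -G x) (fun x => -v x) K L where
  eq_dppOp x hx := by rw [dppOp_neg, ← hv.eq_dppOp x hx]
  eq_boundary x hx := by rw [hv.eq_boundary x hx]
  bound x := by simpa using hv.bound x
  lipschitz x hx y hy := by
    rw [neg_sub_neg, abs_sub_comm]
    exact hv.lipschitz x hx y hy
  measurable := hv.measurable.neg

theorem exists_strategyII_expectedPayoff_le (hn : 0 < n) (hΩ : MeasurableSet Ω)
    (hbdd : Bornology.IsBounded Ω)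
    (hv : IsDppSolution (tugProb n p) (noiseProb n p) ε Ω G v K L)
    (hGF : ∀ x ∈ strip Ω ε, G x = F x) {η : ℝ} (hη : 0 < η) :
    ∃ SII : Strategy n, ∀ SI, ∀ x₀ ∈ Ω ∪ strip Ω ε,
      expectedPayoff hp hε Ω F SI SII x₀ ≤ v x₀ + η := by
  have hδ : ∀ k : ℕ, 0 < η / 2 * (1 / 2) ^ k := fun k => by positivity
  have hw := hv.neg
  obtain ⟨SII, hSII⟩ := exists_near_optimal_strategy hw.bound hδ
  refine ⟨SII, fun SI x₀ hx₀ => ?_⟩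
  have := le_expectedPayoff_add (F := fun x => -F x) hp hε SI SII hn hΩ hbdd hw.measurable hw.bound
    (fun x hx => by rw [hv.eq_boundary x hx.1, hGF x hx]) (fun k => (hδ k).le)
    (sum_half_pow_le hη.le) (fun k h hh => ?_) hx₀
  · rw [expectedPayoff_neg] at this
    linarith
  · rw [integral_nextRound hp hε SI SII hw.measurable hw.bound, hw.eq_dppOp _ hh,
      add_comm (∫ t, _ ∂stepLaw ε)]
    exact dppOp_sub_le_moves hw.measurable hw.bound hp hε (hδ k).le SII SI h (hSII k h)

/-- Uniform boundedness makes the real suprema and infima defining the values genuine ones. -/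
theorem abs_expectedPayoff_le (hn : 0 < n) (hΩ : MeasurableSet Ω)
    (hbdd : Bornology.IsBounded Ω) (hGF : ∀ x ∈ strip Ω ε, G x = F x)
    (hGK : ∀ x, |G x| ≤ K) (SI SII : Strategy n) {x₀ : Space n} (hx₀ : x₀ ∈ Ω ∪ strip Ω ε) :
    |expectedPayoff hp hε Ω F SI SII x₀| ≤ K := by
  have h : ∀ᵐ ω ∂gameLaw hp hε SI SII x₀, ‖payoff Ω F ω‖ ≤ K := by
    filter_upwards [ae_stoppedPos_mem hp hε SI SII hΩ hx₀,
      ae_exists_stoppedPos_notMem hp hε SI SII hn hΩ hbdd x₀] with ω hmem hex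
    obtain ⟨k, hk⟩ := hex
    rw [payoff_eq_of_stoppedPos_notMem F hk, ← hGF _ ((hmem k).resolve_left hk)]
    exact hGK _
  simpa [expectedPayoff] using norm_integral_le_of_norm_le_const h

/-- The values of both players coincide with the solution of the dynamic programming principle. -/
theorem valueI_eq_and_valueII_eq (hn : 0 < n) (hΩ : MeasurableSet Ω) (hbdd : Bornology.IsBounded Ω)
    (hv : IsDppSolution (tugProb n p) (noiseProb n p) ε Ω G v K L)
    (hGF : ∀ x ∈ strip Ω ε, G x = F x) (hGK : ∀ x, |G x| ≤ K) {x₀ : Space n}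
    (hx₀ : x₀ ∈ Ω ∪ strip Ω ε) :
    valueI hp hε Ω F x₀ = v x₀ ∧ valueII hp hε Ω F x₀ = v x₀ := by
  set E := fun SI SII => expectedPayoff hp hε Ω F SI SII x₀ with hE
  have hb : ∀ SI SII, |E SI SII| ≤ K := fun SI SII =>
    abs_expectedPayoff_le hp hε hn hΩ hbdd hGF hGK SI SII hx₀
  have bI : ∀ SI, BddBelow (Set.range fun SII => E SI SII) := fun SI => ⟨-K, by
    rintro _ ⟨SII, rfl⟩
    exact (abs_le.1 (hb SI SII)).1⟩
  have bII : ∀ SII, BddAbove (Set.range fun SI => E SI SII) := fun SII => ⟨K, by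
    rintro _ ⟨SI, rfl⟩
    exact (abs_le.1 (hb SI SII)).2⟩
  have bI' : BddAbove (Set.range fun SI => ⨅ SII, E SI SII) := ⟨K, by
    rintro _ ⟨SI, rfl⟩
    exact (ciInf_le (bI SI) (Classical.arbitrary _)).trans (abs_le.1 (hb SI _)).2⟩
  have bII' : BddBelow (Set.range fun SII => ⨆ SI, E SI SII) := ⟨-K, by
    rintro _ ⟨SII, rfl⟩
    exact (abs_le.1 (hb _ SII)).1.trans (le_ciSup (bII SII) (Classical.arbitrary _))⟩
  have hI := fun η (hη : (0 : ℝ) < η) =>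
    exists_strategyI_le_expectedPayoff hp hε hn hΩ hbdd hv hGF hη
  have hII := fun η (hη : (0 : ℝ) < η) =>
    exists_strategyII_expectedPayoff_le hp hε hn hΩ hbdd hv hGF hη
  refine ⟨le_antisymm ?_ ?_, le_antisymm ?_ ?_⟩
  · refine le_of_forall_pos_le_add fun η hη => ?_
    obtain ⟨SII, h⟩ := hII η hη
    exact ciSup_le fun SI => (ciInf_le (bI SI) SII).trans (h SI x₀ hx₀)
  · refine le_of_forall_pos_le_add fun η hη => ?_
    obtain ⟨SI, h⟩ := hI η hη
    have h1 : v x₀ - η ≤ ⨅ SII, E SI SII := le_ciInf fun SII => h SII x₀ hx₀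
    have h2 : ⨅ SII, E SI SII ≤ valueI hp hε Ω F x₀ := le_ciSup bI' SI
    linarith
  · refine le_of_forall_pos_le_add fun η hη => ?_
    obtain ⟨SII, h⟩ := hII η hη
    exact (ciInf_le bII' SII).trans (ciSup_le fun SI => h SI x₀ hx₀)
  · refine le_of_forall_pos_le_add fun η hη => ?_
    obtain ⟨SI, h⟩ := hI η hη
    have h1 : v x₀ - η ≤ valueII hp hε Ω F x₀ :=
      le_ciInf fun SII => (h SII x₀ hx₀).trans (le_ciSup (bII SII) SI)
    linarith

theorem abs_le_of_ae_abs_le {U : Set (Space n)} (hU : IsOpen U) {u : Space n → ℝ} {M : ℝ}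
    (hu : ContinuousOn u U) (h : ∀ᵐ x ∂volume.restrict U, |u x| ≤ M) : ∀ x ∈ U, |u x| ≤ M := by
  intro x hx
  by_contra! hcon
  have hc : ContinuousOn (fun y => |u y|) U := hu.abs
  have hopen : IsOpen (U ∩ (fun y => |u y|) ⁻¹' Set.Ioi M) := hc.isOpen_inter_preimage hU isOpen_Ioi
  have hpos := hopen.measure_pos volume ⟨x, hx, hcon⟩
  rw [ae_restrict_iff' hU.measurableSet, ae_iff] at h
  refine hpos.ne' (measure_mono_null (fun y hy => ?_) h)
  have := hy.2
  simp only [Set.mem_preimage, Set.mem_Ioi] at this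
  exact fun hcon => (hcon hy.1).not_gt this

/-- Rademacher's theorem on the open set `U`; the Lipschitz constant bounds the derivative. -/
theorem ae_differentiableAt_and_norm_gradient_le {u : Space n → ℝ} {U : Set (Space n)}
    (hU : IsOpen U) {C : ℝ} (hC : 0 ≤ C) (hu : ∀ x ∈ U, ∀ y ∈ U, |u x - u y| ≤ C * ‖x - y‖) :
    ∀ᵐ z ∂volume.restrict U, DifferentiableAt ℝ u z ∧ ‖gradient u z‖ ≤ C := by
  have hlip : LipschitzOnWith C.toNNReal u U := LipschitzOnWith.of_dist_le_mul fun x hx y hy => by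
    rw [Real.dist_eq, Real.coe_toNNReal C hC, dist_eq_norm]
    exact hu x hx y hy
  filter_upwards [hlip.ae_differentiableWithinAt (μ := volume) hU.measurableSet,
    ae_restrict_mem hU.measurableSet] with z hz hzU
  refine ⟨hz.differentiableAt (hU.mem_nhds hzU), ?_⟩
  rw [gradient, LinearIsometryEquiv.norm_map]
  have := norm_fderiv_le_of_lipschitzOn ℝ (hU.mem_nhds hzU) hlip
  rwa [Real.coe_toNNReal C hC] at this

end Value

end RandomStepTug

end

/-! ### Assembly of the theorem -/

open RandomStepTug in
theorem theorem3p2 (n : ℕ) (hn : 2 ≤ n) (p : ℝ) (hp : 2 < p) (r : ℝ) (hr : 0 < r) (M : ℝ≥0) :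
    ∃ C : ℝ, 0 < C ∧
      ∀ (Ω : Set (Space n)), IsOpen Ω → Bornology.IsBounded Ω →
      ∀ (ε : ℝ) (hε : 0 < ε), ε < r →
      ∀ (F : Space n → ℝ), Measurable ((strip Ω ε).domRestrict F) →
        (∃ K : ℝ, ∀ x ∈ strip Ω ε, |F x| ≤ K) →
      ∀ (z₀ : Space n), ball z₀ (5 * r) ⊆ Ω →
      ∀ (u : Space n → ℝ), u = valueI hp hε Ω F →
        eLpNorm u ∞ (volume.restrict (Ω ∪ strip Ω ε)) ≤ M →
        (∀ x ∈ Ω ∪ strip Ω ε, valueII hp hε Ω F x = u x) ∧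
        (∀ x ∈ ball z₀ (2 * r), ∀ y ∈ ball z₀ (2 * r), |u x - u y| ≤ C * ‖x - y‖) ∧
        ∀ᵐ z ∂(volume.restrict (ball z₀ r)),
          DifferentiableAt ℝ u z ∧ ‖gradient u z‖ ≤ C := by
  have hα := tugProb_pos n hp
  have hβ := noiseProb_pos n hp
  have hαβ := tugProb_add_noiseProb n hp
  have hC : 0 < (8 * (n + 1)) * (60 * (2 * M + 1) / (tugProb n p * r)) := by positivity
  refine ⟨_, hC, ?_⟩
  intro Ω hΩ hbdd ε hε hεr F hFm ⟨K, hFK⟩ z₀ hz₀ u hu huM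
  set C := (8 * (n + 1)) * (60 * (2 * M + 1) / (tugProb n p * r))
  have hstrip := measurableSet_strip hΩ.measurableSet ε
  -- `F` is controlled only on the strip; the zero extension is a bounded Borel function on the
  -- whole space. The bound `max K 0` covers a negative `K`, possible if the strip is empty.
  set G := (strip Ω ε).indicator F with hG
  have hGm : Measurable G := by
    refine measurable_of_restrict_of_restrict_compl hstrip ?_ ?_
    · have h : (strip Ω ε).domRestrict G = (strip Ω ε).domRestrict F :=
        funext fun x => Set.indicator_of_mem x.2 F
      rwa [h]
    · have h : (strip Ω ε)ᶜ.domRestrict G = fun _ => 0 :=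
        funext fun x => Set.indicator_of_notMem x.2 F
      rw [h]
      exact measurable_const
  have hGF : ∀ x ∈ strip Ω ε, G x = F x := fun x hx => Set.indicator_of_mem hx F
  have hGK : ∀ x, |G x| ≤ max K 0 := fun x => by
    by_cases hx : x ∈ strip Ω ε
    · rw [hGF x hx]
      exact (hFK x hx).trans (le_max_left _ _)
    · rw [hG, Set.indicator_of_notMem hx, abs_zero]
      exact le_max_right _ _
  obtain ⟨v, hv⟩ := exists_isDppSolution hα.le hβ.le hαβ hε hΩ hGm hGK
  have hval : ∀ x ∈ Ω ∪ strip Ω ε, valueI hp hε Ω F x = v x ∧ valueII hp hε Ω F x = v x :=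
    fun x hx => valueI_eq_and_valueII_eq hp hε (by omega) hΩ.measurableSet hbdd hv hGF hGK hx
  have huv : ∀ x ∈ Ω ∪ strip Ω ε, u x = v x := fun x hx => by rw [hu, (hval x hx).1]
  have hvc : ContinuousOn v Ω := (LipschitzOnWith.of_dist_le' fun x hx y hy => by
    rw [Real.dist_eq]
    exact hv.lipschitz x hx y hy).continuousOn
  -- The essential bound on `u` becomes pointwise for `v` by continuity in `Ω`. Hence `C` depends on
  -- `M` and not on the bound for `F`.
  have hvM : ∀ x ∈ Ω, |v x| ≤ M := by
    refine abs_le_of_ae_abs_le hΩ hvc ?_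
    have h1 : ∀ᵐ x ∂volume.restrict (Ω ∪ strip Ω ε), ‖u x‖ₑ ≤ M := by
      filter_upwards [ae_le_eLpNormEssSup (f := u)] with x hx
      exact hx.trans (eLpNorm_exponent_top (f := u) ▸ huM)
    filter_upwards [ae_restrict_of_ae_restrict_of_subset Set.subset_union_left h1,
      ae_restrict_mem hΩ.measurableSet] with x hx hxΩ
    rw [← huv x (.inl hxΩ)]
    rw [← ofReal_norm, ← ENNReal.ofReal_coe_nnreal, ENNReal.ofReal_le_ofReal_iff M.coe_nonneg] at hx
    exact hx
  have h25 : ball z₀ (2 * r) ⊆ ball z₀ (5 * r) := ball_subset_ball (by linarith)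
  have hlip : ∀ x ∈ ball z₀ (2 * r), ∀ y ∈ ball z₀ (2 * r), |u x - u y| ≤ C * ‖x - y‖ := by
    intro x hx y hy
    rw [huv x (.inl (hz₀ (h25 hx))), huv y (.inl (hz₀ (h25 hy))), ← dist_eq_norm]
    exact abs_sub_le_mul_dist_of_dpp hα hβ.le hαβ hv.measurable hv.bound hε hεr M.coe_nonneg
      (fun x hx => hv.eq_dppOp x (hz₀ hx)) (fun x hx => hvM x (hz₀ hx)) hx hy
  have h12 : ball z₀ r ⊆ ball z₀ (2 * r) := ball_subset_ball (by linarith)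
  exact ⟨fun x hx => by rw [(hval x hx).2, huv x hx], hlip,
    ae_differentiableAt_and_norm_gradient_le isOpen_ball hC.le fun x hx y hy =>
      hlip x (h12 hx) y (h12 hy)⟩
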